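/- Let $X$ be a complex Banach space and $A:D(A)\subset X\to X$ a closed, densely defined linear operator. For $\theta\in(0,\pi/2]$ put $\Sigma_\theta=\{\lambda\in\mathbb C\setminus\{0\}:|\arg\lambda|<\pi/2+\theta\}$. Assume that $A$ is sectorial: for some $\theta_0\in(0,\pi/2]$ and $C>0$ the resolvent $R(\lambda,A)=(\lambda-A)^{-1}$ exists and is analytic on $\Sigma_{\theta_0}$, with $\|R(\lambda,A)\|\le C/|\lambda|$ there. Let $\alpha\in(0,1)$, $T>0$, and $\theta_1=\min\{\frac{\pi(1-\alpha)+2\theta_0}{2\alpha},\frac{\pi}{2}\}$. Let $g\in C^1([0,T),D(A))$, where $D(A)$ carries the graph norm, and consider $$\partial_t^\alpha u(t)=Au(t)+g(t)\quad\text{for } t\in(0,T),\qquad u(0)=0,$$ with Caputo's derivative $\partial_t^\alpha u(t)=\frac{1}{\Gamma(1-\alpha)}\int_0^t(t-\tau)^{-\alpha}u'(\tau)\,d\tau$. Write $\Phi_{1-\alpha}(t)=t^{-\alpha}/\Gamma(1-\alpha)$ for $t>0$. A strong solution is a function $u\in C([0,T),X)$ with $u(0)=0$, $u\in C((0,T),D(A))$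 and $\Phi_{1-\alpha}*u\in C^1((0,T),X)$, differentiable on $(0,T)$ with $\tau\mapsto(t-\tau)^{-\alpha}u'(\tau)$ integrable on $(0,t)$ for every $t\in(0,T)$, that satisfies the equation on $(0,T)$. Let $\Gamma$ be a piecewise $C^1$ contour in $\Sigma_{\theta_1}$, both of whose ends go to infinity with tangent directions making acute (positive) angles with the negative real half-axis in the limit, and which is oriented counter-clockwise, i.e. from the lower to the upper end (such contours exist). For $t>0$ let $$P_\alpha(t)=\frac{1}{2\pi i}\int_\Gamma e^{\lambda t}R(\lambda^\alpha,A)\,d\lambda .$$ Then this integral converges absolutely for every $t>0$, and $P_\alpha$ is the inverse Laplace transform of $R(\lambda^\alpha,A)$: for $\operatorname{Re}\lambda>0$ the integral $\int_0^\infty e^{-\lambda t}P_\alpha(t)\,dt$ converges absolutely and equals $R(\lambda^\alpha,A)$. The equation has exactly one strong solution on $[0,T)$, namely $$u(t)=(P_\alpha*g)(t)=\int_0^tP_\alpha(t-\tau)g(\tau)\,d\tau,\qquad t\in[0,T),$$ where the integral converges. Moreover $u\in C([0,T),D(A))$ and $\Phi_{1-\alpha}*u\in C^1([0,T),X)$,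 and uniqueness also holds among the functions $u\in C([0,T),X)$ with $u(0)=0$, $u\in C((0,T),D(A))$ and $\Phi_{1-\alpha}*u\in C^1((0,T),X)$ that satisfy the equation with $\partial_t^\alpha u$ read as $\frac{d}{dt}(\Phi_{1-\alpha}*u)$. -/

import Mathlib

open MeasureTheory Set Filter Topology

namespace FracEvol

noncomputable section

/-- The open sector of all `z ≠ 0` with `|arg z| < π / 2 + θ`. -/
def sector (θ : ℝ) : Set ℂ :=
  {z : ℂ | z ≠ 0 ∧ |z.arg| < Real.pi / 2 + θ}

/-- The angle `θ₁ = min {(π (1 - α) + 2 θ₀) / (2 α), π / 2}`. -/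
def angleOne (α θ₀ : ℝ) : ℝ :=
  min ((Real.pi * (1 - α) + 2 * θ₀) / (2 * α)) (Real.pi / 2)

/-- `Φ_β(t) = t ^ (β - 1) / Γ(β)` for `t > 0`, and `0` for `t ≤ 0`. -/
def Phi (β t : ℝ) : ℝ :=
  if 0 < t then t ^ (β - 1) / Real.Gamma β else 0

section Banach

variable {X : Type*} [NormedAddCommGroup X] [NormedSpace ℂ X]

open Classical in
/-- The value `A x` for `x ∈ D(A)`. The value `0` outside `D(A)` is a convention only; membership
in the domain is always required separately. -/
def opApply (A : X →ₗ.[ℂ] X) (x : X) : X :=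
  if h : x ∈ A.domain then A ⟨x, h⟩ else 0

/-- The bounded operator `R` is a two-sided inverse of `z - A : D(A) → X`. -/
def IsResolventAt (A : X →ₗ.[ℂ] X) (z : ℂ) (R : X →L[ℂ] X) : Prop :=
  (∀ x : X, R x ∈ A.domain ∧ z • R x - opApply A (R x) = x) ∧
    ∀ x ∈ A.domain, R (z • x - opApply A x) = x

/-- The resolvent set of `A`. -/
def resolventSet (A : X →ₗ.[ℂ] X) : Set ℂ :=
  {z : ℂ | ∃ R : X →L[ℂ] X, IsResolventAt A z R}

open Classical in
/-- The resolvent `(z - A)⁻¹`, for `z` in the resolvent set (`0` elsewhere). -/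
def res (A : X →ₗ.[ℂ] X) (z : ℂ) : X →L[ℂ] X :=
  if h : ∃ R : X →L[ℂ] X, IsResolventAt A z R then h.choose else 0

/-- `A` is sectorial with angle `θ₀`: its resolvent exists and is analytic in the sector, and it is
bounded there by `C / |z|`. -/
structure IsSectorial (A : X →ₗ.[ℂ] X) (θ₀ : ℝ) : Prop where
  angle_pos : 0 < θ₀
  angle_le : θ₀ ≤ Real.pi / 2
  subset_resolventSet : sector θ₀ ⊆ resolventSet A
  analytic : DifferentiableOn ℂ (res A) (sector θ₀)
  bound : ∃ C : ℝ, 0 < C ∧ ∀ z ∈ sector θ₀, ‖res A z‖ ≤ C / ‖z‖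

/-- `f ∈ C(J, D(A))`, where `D(A)` carries the graph norm: the pair `(f, A f)` is continuous. -/
def ContinuousOnDomain (A : X →ₗ.[ℂ] X) (f : ℝ → X) (J : Set ℝ) : Prop :=
  (∀ t ∈ J, f t ∈ A.domain) ∧ ContinuousOn (fun t => (f t, opApply A (f t))) J

/-- `f ∈ C¹(J, D(A))`, where `D(A)` carries the graph norm: the pair `(f, A f)` is `C¹`
(with one-sided derivatives at an endpoint that belongs to the interval `J`). -/
def C1OnDomain (A : X →ₗ.[ℂ] X) (f : ℝ → X) (J : Set ℝ) : Prop :=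
  (∀ t ∈ J, f t ∈ A.domain) ∧ ContDiffOn ℝ 1 (fun t => (f t, opApply A (f t))) J

/-- The convolution `(Φ_β * f)(t)` over `(0, t)`. -/
def phiConv (β : ℝ) (f : ℝ → X) (t : ℝ) : X :=
  ∫ s in (0 : ℝ)..t, Phi β (t - s) • f s

/-- Caputo's derivative `(1 / Γ(1 - α)) ∫₀ᵗ (t - s) ^ (-α) u'(s) ds`. -/
def caputoDeriv (α : ℝ) (u : ℝ → X) (t : ℝ) : X :=
  (1 / Real.Gamma (1 - α)) • ∫ s in (0 : ℝ)..t, (t - s) ^ (-α) • deriv u s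

/-- The regularity asked of a strong solution on a time interval `J`, which is `(0, T)` or `[0, T)`:
`u` is continuous on `J ∪ {0}` with `u(0) = u₀`, `u ∈ C(J, D(A))`,
and `Φ_{1-α} * (u - u₀) ∈ C¹(J, X)`. -/
structure HasStrongRegularity (A : X →ₗ.[ℂ] X) (α : ℝ) (J : Set ℝ) (u₀ : X) (u : ℝ → X) :
    Prop where
  initial : u 0 = u₀
  continuousOn : ContinuousOn u (insert 0 J)
  domain : ContinuousOnDomain A u J
  conv_c1 : ContDiffOn ℝ 1 (phiConv (1 - α) fun s => u s - u₀) J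

/-- A strong solution of `∂_t^α u = A u + g` on `(0, T)` with `u(0) = u₀`. The two fields before the
equation say that the integral that defines Caputo's derivative makes sense. -/
structure IsStrongSolution (A : X →ₗ.[ℂ] X) (α T : ℝ) (u₀ : X) (g u : ℝ → X) : Prop where
  regularity : HasStrongRegularity A α (Ioo 0 T) u₀ u
  differentiable : ∀ t ∈ Ioo (0 : ℝ) T, DifferentiableAt ℝ u t
  integrable : ∀ t ∈ Ioo (0 : ℝ) T,
    IntervalIntegrable (fun s => (t - s) ^ (-α) • deriv u s) volume 0 t
  equation : ∀ t ∈ Ioo (0 : ℝ) T, caputoDeriv α u t = opApply A (u t) + g t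

/-- The same notion with Caputo's derivative read in its regularized form
`d/dt (Φ_{1-α} * (u - u₀))`, which needs no derivative of `u` itself. -/
structure IsRegularizedStrongSolution (A : X →ₗ.[ℂ] X) (α T : ℝ) (u₀ : X) (g u : ℝ → X) :
    Prop where
  regularity : HasStrongRegularity A α (Ioo 0 T) u₀ u
  equation : ∀ t ∈ Ioo (0 : ℝ) T,
    deriv (phiConv (1 - α) fun s => u s - u₀) t = opApply A (u t) + g t

/-- `γ` parametrizes a contour in the sector of angle `θ`: it is continuous and piecewise `C¹` with
locally integrable derivative, it stays in the sector, and it goes to infinity at both ends, its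
tangent direction there making an acute angle (`ψ₁` below, `ψ₂` above) with the negative
real half-axis. It is run through counter-clockwise, that is, from the lower end to the upper. -/
structure IsContour (θ : ℝ) (γ : ℝ → ℂ) : Prop where
  continuous : Continuous γ
  piecewise_c1 : ∃ S : Finset ℝ, (∀ x ∉ S, DifferentiableAt ℝ γ x) ∧
    ContinuousOn (deriv γ) (S : Set ℝ)ᶜ
  locallyIntegrable : LocallyIntegrable (deriv γ) volume
  mem_sector : ∀ x, γ x ∈ sector θ
  lower_end : Tendsto (fun x => ‖γ x‖) atBot atTop
  upper_end : Tendsto (fun x => ‖γ x‖) atTop atTop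
  lower_angle : ∃ ψ₁ : ℝ, 0 < ψ₁ ∧ ψ₁ < Real.pi / 2 ∧
    Tendsto (fun x => deriv γ x / (‖deriv γ x‖ : ℂ)) atBot
      (𝓝 (-Complex.exp (-((Real.pi - ψ₁ : ℝ) : ℂ) * Complex.I)))
  upper_angle : ∃ ψ₂ : ℝ, 0 < ψ₂ ∧ ψ₂ < Real.pi / 2 ∧
    Tendsto (fun x => deriv γ x / (‖deriv γ x‖ : ℂ)) atTop
      (𝓝 (Complex.exp (((Real.pi - ψ₂ : ℝ) : ℂ) * Complex.I)))

/-- The integrand `e^{z t} (z^α - A)⁻¹ dz` along `z = γ(x)`; the power is the principal one. -/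
def contourIntegrand (A : X →ₗ.[ℂ] X) (α : ℝ) (γ : ℝ → ℂ) (t x : ℝ) : X →L[ℂ] X :=
  (Complex.exp (γ x * (t : ℂ)) * deriv γ x) • res A (γ x ^ (α : ℂ))

/-- `P_α(t) = (1 / (2 π i)) ∫_γ e^{z t} (z^α - A)⁻¹ dz`. -/
def opP (A : X →ₗ.[ℂ] X) (α : ℝ) (γ : ℝ → ℂ) (t : ℝ) : X →L[ℂ] X :=
  (1 / (2 * (Real.pi : ℂ) * Complex.I)) • ∫ x : ℝ, contourIntegrand A α γ t x

/-- The convolution `(P_α * g)(t) = ∫₀ᵗ P_α(t - s) g(s) ds`. -/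
def convP (A : X →ₗ.[ℂ] X) (α : ℝ) (γ : ℝ → ℂ) (g : ℝ → X) (t : ℝ) : X :=
  ∫ s in (0 : ℝ)..t, opP A α γ (t - s) (g s)

end Banach

end

end FracEvol

open FracEvol

/-!
Write `L z = (z ^ α - A)⁻¹`, which is holomorphic on the sector of angle `θ₁` and of size
`|z| ^ (-α)` there. By Cauchy's theorem the contour of `P t = (2πi)⁻¹ ∫ e^{z t} L z dz` can be moved
to a wedge, that is, to two rays which start at some `ε > 0`, and `ε = 1 / t` gives
`‖P t‖ ≤ M t ^ (α - 1)`. That the Laplace transform of `P` is `L` follows from Fubini's theorem and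
Cauchy's formula on the wedge, where the residue at `z` is read off as the increment of
`log w - log (z - w)`.

All identities between convolutions, above all `Φ_{1-α} * (P * h) = 1 * h + 1 * (P * A h)`, come
from comparing Laplace transforms, which determine a continuous function. For `h = g` this identity
is the integrated equation for `P * g`. Conversely, let `w` be the difference of two solutions and
`R = (1 - A)⁻¹`. Then `h = R w` takes values in the domain of `A` with `A h` continuous up to `0`,
and it satisfies `Φ_{1-α} * h = 1 * A h`. Convolving this with `P` and comparing with the identity
leaves `1 * h = 0`, so that `h = 0` and `w = 0`.

Finally, Caputo's derivative and its regularized form agree because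
`Φ_{1-α} * (1 * u') = 1 * (Φ_{1-α} * u')`.
-/

namespace FracEvol

noncomputable section

/-! ### Sectors and contours -/

section Sector

variable {θ : ℝ}

theorem mem_sector_iff (h₀ : 0 < θ) (h₁ : θ ≤ Real.pi / 2) (z : ℂ) :
    z ∈ sector θ ↔ 0 < z.re ∨ 0 < z.re * Real.cos θ + |z.im| * Real.sin θ := by
  rcases eq_or_ne z 0 with rfl | hz
  · simp [sector]
  have hnorm : 0 < ‖z‖ := norm_pos_iff.2 hz
  have hre : z.re = ‖z‖ * Real.cos |z.arg| := by
    rw [Real.cos_abs, Complex.norm_mul_cos_arg]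
  have him : |z.im| = ‖z‖ * Real.sin |z.arg| := by
    rw [← Real.abs_sin_eq_sin_abs_of_abs_le_pi (Complex.abs_arg_le_pi z),
      ← Complex.norm_mul_sin_arg z, abs_mul, abs_norm]
  have hrotated : z.re * Real.cos θ + |z.im| * Real.sin θ = ‖z‖ * Real.cos (|z.arg| - θ) := by
    rw [hre, him, Real.cos_sub]; ring
  have harg_le := Complex.abs_arg_le_pi z
  have harg_nonneg := abs_nonneg z.arg
  rw [hrotated, hre, mul_pos_iff_of_pos_left hnorm, mul_pos_iff_of_pos_left hnorm]
  constructor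
  · rintro ⟨-, h⟩
    rcases harg_nonneg.eq_or_lt with h' | h'
    · left; simp [← h']
    · right; exact Real.cos_pos_of_mem_Ioo ⟨by linarith, by linarith⟩
  · refine fun h => ⟨hz, lt_of_not_ge fun hge => h.elim (fun h => h.not_ge ?_) fun h => h.not_ge ?_⟩
    · exact Real.cos_nonpos_of_pi_div_two_le_of_le (by linarith) (by linarith)
    · exact Real.cos_nonpos_of_pi_div_two_le_of_le (by linarith) (by linarith)

theorem isOpen_sector (h₀ : 0 < θ) (h₁ : θ ≤ Real.pi / 2) : IsOpen (sector θ) := by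
  have : sector θ = {z : ℂ | 0 < z.re} ∪ {z : ℂ | 0 < z.re * Real.cos θ + |z.im| * Real.sin θ} :=
    Set.ext (mem_sector_iff h₀ h₁)
  rw [this]
  exact (isOpen_lt (by fun_prop) (by fun_prop)).union (isOpen_lt (by fun_prop) (by fun_prop))

theorem sector_subset_slitPlane (h₁ : θ ≤ Real.pi / 2) : sector θ ⊆ Complex.slitPlane := by
  rintro z ⟨hz, harg⟩
  refine Complex.mem_slitPlane_iff_arg.2 ⟨fun hpi => ?_, hz⟩
  rw [hpi, abs_of_pos Real.pi_pos] at harg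
  linarith

theorem mem_sector_of_re_pos (h₀ : 0 < θ) {z : ℂ} (hz : 0 < z.re) : z ∈ sector θ := by
  refine ⟨fun h => by simp [h] at hz, ?_⟩
  linarith [Complex.abs_arg_lt_pi_div_two_iff.2 (Or.inl hz)]

theorem ofReal_mul_mem_sector {r : ℝ} (hr : 0 < r) {z : ℂ} (hz : z ∈ sector θ) :
    (r : ℂ) * z ∈ sector θ := by
  refine ⟨mul_ne_zero (by exact_mod_cast hr.ne') hz.1, ?_⟩
  rw [Complex.arg_real_mul _ hr]
  exact hz.2

theorem conj_mem_sector (h₁ : θ ≤ Real.pi / 2) {z : ℂ} (hz : z ∈ sector θ) :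
    (starRingEnd ℂ) z ∈ sector θ := by
  have harg := (Complex.mem_slitPlane_iff_arg.1 (sector_subset_slitPlane h₁ hz)).1
  refine ⟨by simpa using hz.1, ?_⟩
  rw [Complex.arg_conj, if_neg harg, abs_neg]
  exact hz.2

theorem polar_mem_sector {r φ : ℝ} (h₁ : θ ≤ Real.pi / 2) (hr : 0 < r)
    (hφ : |φ| < Real.pi / 2 + θ) : (r : ℂ) * Complex.exp (φ * Complex.I) ∈ sector θ := by
  refine ofReal_mul_mem_sector hr ⟨Complex.exp_ne_zero _, ?_⟩
  obtain ⟨hlow, hup⟩ := abs_lt.1 hφ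
  rwa [Complex.arg_exp_mul_I, (toIocMod_eq_self _).2 ⟨by linarith, by linarith⟩]

theorem angleOne_pos {α θ₀ : ℝ} (hα₀ : 0 < α) (hα₁ : α < 1) (h₀ : 0 < θ₀) :
    0 < angleOne α θ₀ := by
  have := mul_pos Real.pi_pos (sub_pos.2 hα₁)
  exact lt_min (by positivity) (by positivity)

theorem angleOne_le (α θ₀ : ℝ) : angleOne α θ₀ ≤ Real.pi / 2 := min_le_right _ _

theorem cpow_mem_sector {α θ₀ : ℝ} (hα₀ : 0 < α) (h₁ : θ₀ ≤ Real.pi / 2) {z : ℂ}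
    (hz : z ∈ sector (angleOne α θ₀)) : z ^ (α : ℂ) ∈ sector θ₀ := by
  have hangle : |z.arg * α| < Real.pi / 2 + θ₀ := by
    have hle : angleOne α θ₀ ≤ (Real.pi * (1 - α) + 2 * θ₀) / (2 * α) := min_le_left _ _
    rw [le_div_iff₀ (by linarith)] at hle
    rw [abs_mul, abs_of_pos hα₀]
    nlinarith [mul_lt_mul_of_pos_left hz.2 hα₀]
  rw [Complex.cpow_ofReal z α, Complex.ofReal_cos, Complex.ofReal_sin, ← Complex.exp_mul_I]
  exact polar_mem_sector h₁ (Real.rpow_pos_of_pos (norm_pos_iff.2 hz.1) _) hangle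

theorem exists_primitive_sector {E : Type*} [NormedAddCommGroup E] [NormedSpace ℂ E]
    [CompleteSpace E] (h₁ : θ ≤ Real.pi / 2) {F : ℂ → E} (hF : DifferentiableOn ℂ F (sector θ)) :
    ∃ G : ℂ → E, ∀ z ∈ sector θ, HasDerivAt G (F z) z := by
  -- The exponential maps a convex strip onto the sector, and on the strip primitives exist.
  set strip : Set ℂ := Complex.im ⁻¹' Ioo (-(Real.pi / 2 + θ)) (Real.pi / 2 + θ)
  have hconv : Convex ℝ strip := (convex_Ioo _ _).is_linear_preimage Complex.imLm.isLinear
  have hopen : IsOpen strip := isOpen_Ioo.preimage Complex.continuous_im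
  have hexp : ∀ w ∈ strip, Complex.exp w ∈ sector θ := fun w hw => by
    have := polar_mem_sector h₁ (Real.exp_pos w.re) (φ := w.im) (abs_lt.2 hw)
    rwa [Complex.ofReal_exp, ← Complex.exp_add, Complex.re_add_im] at this
  have hd : DifferentiableOn ℂ (fun w => Complex.exp w • F (Complex.exp w)) strip :=
    Complex.differentiable_exp.differentiableOn.smul
      (hF.comp Complex.differentiable_exp.differentiableOn hexp)
  obtain ⟨g, hg⟩ := hconv.exists_forall_hasDerivWithinAt hd
  refine ⟨fun z => g (Complex.log z), fun z hz => ?_⟩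
  have hlog : Complex.log z ∈ strip := by
    change (Complex.log z).im ∈ Ioo _ _
    rw [Complex.log_im]
    exact abs_lt.1 hz.2
  have h := ((hg _ hlog).hasDerivAt (hopen.mem_nhds hlog)).scomp z
    (Complex.hasDerivAt_log (sector_subset_slitPlane h₁ hz))
  rwa [Complex.exp_log hz.1, smul_smul, inv_mul_cancel₀ hz.1, one_smul] at h

end Sector

section Ends

variable {θ : ℝ} {γ : ℝ → ℂ}

/-- The mirror image of a contour in the real axis, run through backwards. It turns statements about
the upper end into statements about the lower end. -/
def reflect (γ : ℝ → ℂ) (x : ℝ) : ℂ := (starRingEnd ℂ) (γ (-x))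

theorem deriv_reflect (γ : ℝ → ℂ) (x : ℝ) :
    deriv (reflect γ) x = -(starRingEnd ℂ) (deriv γ (-x)) := by
  have hstar : deriv (fun y => star (γ (-y))) x = star (deriv (fun y => γ (-y)) x) := deriv.star
  rw [deriv_comp_neg, star_neg] at hstar
  exact hstar

theorem differentiableAt_reflect {x : ℝ} (h : DifferentiableAt ℝ γ (-x)) :
    DifferentiableAt ℝ (reflect γ) x :=
  (h.comp x differentiable_neg.differentiableAt).star

theorem conj_exp_ofReal_mul_I (r : ℝ) :
    (starRingEnd ℂ) (Complex.exp (r * Complex.I)) = Complex.exp (-r * Complex.I) := by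
  simp [← Complex.exp_conj]

theorem locallyIntegrable_conj_comp_neg {f : ℝ → ℂ} (hf : LocallyIntegrable f) :
    LocallyIntegrable fun x => (starRingEnd ℂ) (f (-x)) := fun x => by
  obtain ⟨U, hU, hi⟩ := hf (-x)
  refine ⟨Neg.neg ⁻¹' U, continuous_neg.continuousAt.preimage_mem_nhds hU, ?_⟩
  exact Complex.conjCLE.toContinuousLinearMap.integrable_comp
    (((Measure.measurePreserving_neg volume).integrableOn_comp_preimage
      (Homeomorph.neg ℝ).measurableEmbedding).2 hi)

theorem IsContour.reflect (h₁ : θ ≤ Real.pi / 2) (h : IsContour θ γ) :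
    IsContour θ (reflect γ) := by
  have hd : deriv (FracEvol.reflect γ) = fun x => -(starRingEnd ℂ) (deriv γ (-x)) :=
    funext (deriv_reflect γ)
  refine ⟨Complex.continuous_conj.comp (h.continuous.comp continuous_neg), ?_, ?_,
    fun x => conj_mem_sector h₁ (h.mem_sector _), ?_, ?_, ?_, ?_⟩
  · obtain ⟨S, hS, hS'⟩ := h.piecewise_c1
    have hmem : ∀ x ∉ S.image Neg.neg, -x ∉ S := fun x hx hmem =>
      hx (Finset.mem_image.2 ⟨-x, hmem, neg_neg x⟩)
    refine ⟨S.image Neg.neg, fun x hx => differentiableAt_reflect (hS _ (hmem x hx)), ?_⟩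
    rw [hd]
    exact (Complex.continuous_conj.comp_continuousOn
      (hS'.comp continuous_neg.continuousOn fun x hx => hmem x hx)).neg
  · rw [hd]
    exact (locallyIntegrable_conj_comp_neg h.locallyIntegrable).neg
  · simpa [Function.comp_def, FracEvol.reflect] using h.upper_end.comp tendsto_neg_atBot_atTop
  · simpa [Function.comp_def, FracEvol.reflect] using h.lower_end.comp tendsto_neg_atTop_atBot
  · obtain ⟨ψ, hψ₀, hψ₁, htangent⟩ := h.upper_angle
    refine ⟨ψ, hψ₀, hψ₁, ?_⟩
    convert! ((Complex.continuous_conj.tendsto _).comp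
      (htangent.comp tendsto_neg_atBot_atTop)).neg using 2 with x
    · simp [hd, neg_div]
    · rw [conj_exp_ofReal_mul_I]
  · obtain ⟨ψ, hψ₀, hψ₁, htangent⟩ := h.lower_angle
    refine ⟨ψ, hψ₀, hψ₁, ?_⟩
    convert! ((Complex.continuous_conj.tendsto _).comp
      (htangent.comp tendsto_neg_atTop_atBot)).neg using 2 with x
    · simp [hd, neg_div]
    · rw [← conj_exp_ofReal_mul_I]; simp

theorem eventually_mul_norm_le_of_tendsto_div_norm {f : ℝ → ℂ} {l : Filter ℝ} {e : ℂ}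
    (hf : Tendsto (fun x => f x / (‖f x‖ : ℂ)) l (𝓝 e)) (φ : ℂ →L[ℝ] ℝ) {c : ℝ} (hc : c < φ e) :
    ∀ᶠ x in l, c * ‖f x‖ ≤ φ (f x) := by
  filter_upwards [((φ.continuous.tendsto e).comp hf).eventually_const_lt hc] with x hx
  have hscale : f x = ‖f x‖ • (f x / (‖f x‖ : ℂ)) := by
    rcases eq_or_ne (f x) 0 with h | h
    · simp [h]
    · rw [Complex.real_smul, mul_div_cancel₀ _ (by simpa using h)]
  calc c * ‖f x‖ ≤ φ (f x / (‖f x‖ : ℂ)) * ‖f x‖ := by gcongr; exact hx.le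
    _ = φ (f x) := by conv_rhs => rw [hscale, map_smul, smul_eq_mul, mul_comm]

theorem IsContour.intervalIntegrable_deriv (h : IsContour θ γ) (a b : ℝ) :
    IntervalIntegrable (deriv γ) volume a b :=
  (h.locallyIntegrable.integrableOn_isCompact isCompact_uIcc).intervalIntegrable

theorem IsContour.integral_deriv (h : IsContour θ γ) (a b : ℝ) :
    ∫ x in a..b, deriv γ x = γ b - γ a := by
  obtain ⟨S, hS, -⟩ := h.piecewise_c1
  exact integral_eq_of_hasDerivAt_off_countable _ _ S.countable_toSet h.continuous.continuousOn
    (fun x hx => (hS x hx.2).hasDerivAt) (h.intervalIntegrable_deriv a b)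

theorem IsContour.mul_norm_sub_le (h : IsContour θ γ) (φ : ℂ →L[ℝ] ℝ) {c a b : ℝ}
    (hc : 0 ≤ c) (hab : a ≤ b) (hφ : ∀ x ∈ Icc a b, c * ‖deriv γ x‖ ≤ φ (deriv γ x)) :
    c * ‖γ b - γ a‖ ≤ φ (γ b) - φ (γ a) := by
  have hi := h.intervalIntegrable_deriv a b
  rw [← map_sub, ← h.integral_deriv a b, ← φ.intervalIntegral_comp_comm hi]
  calc c * ‖∫ y in a..b, deriv γ y‖ ≤ c * ∫ y in a..b, ‖deriv γ y‖ := by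
        gcongr
        exact intervalIntegral.norm_integral_le_integral_norm hab
    _ = ∫ y in a..b, c * ‖deriv γ y‖ := by rw [intervalIntegral.integral_const_mul]
    _ ≤ ∫ y in a..b, φ (deriv γ y) := intervalIntegral.integral_mono_on hab (hi.norm.const_mul c)
        ⟨φ.integrable_comp hi.1, φ.integrable_comp hi.2⟩ hφ

theorem IsContour.eventually_mul_norm_le (h : IsContour θ γ) (φ : ℂ →L[ℝ] ℝ) {c c' : ℝ}
    (hc' : 0 ≤ c') (hcc' : c' < c) (hφ : ∀ᶠ x in atTop, c * ‖deriv γ x‖ ≤ φ (deriv γ x)) :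
    ∀ᶠ x in atTop, c' * ‖γ x‖ ≤ φ (γ x) := by
  obtain ⟨a, ha⟩ := eventually_atTop.1 hφ
  filter_upwards [eventually_ge_atTop a,
    h.upper_end.eventually_ge_atTop ((c * ‖γ a‖ - φ (γ a)) / (c - c'))] with x hax hx
  have hgrowth := h.mul_norm_sub_le φ (hc'.trans hcc'.le) hax fun y hy => ha y hy.1
  have htriangle : c * ‖γ x‖ ≤ c * ‖γ x - γ a‖ + c * ‖γ a‖ := by
    rw [← mul_add]
    exact mul_le_mul_of_nonneg_left (norm_le_norm_sub_add _ _) (hc'.trans hcc'.le)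
  rw [div_le_iff₀ (sub_pos.2 hcc')] at hx
  linarith

theorem IsContour.eventually_differentiableAt (h : IsContour θ γ) :
    ∀ᶠ x in atTop, DifferentiableAt ℝ γ x := by
  obtain ⟨S, hS, -⟩ := h.piecewise_c1
  obtain ⟨M, hM⟩ := S.bddAbove
  filter_upwards [eventually_gt_atTop M] with x hx
  exact hS x fun hxS => hx.not_ge (hM hxS)

theorem IsContour.upper_estimates (h : IsContour θ γ) :
    ∃ c > 0, ∀ᶠ x in atTop, c * ‖deriv γ x‖ ≤ -(deriv γ x).re ∧
      c * ‖γ x‖ ≤ -(γ x).re ∧ 0 < (γ x).im := by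
  obtain ⟨ψ, hψ₀, hψ₁, htangent⟩ := h.upper_angle
  have hcos : 0 < Real.cos ψ := Real.cos_pos_of_mem_Ioo ⟨by linarith, hψ₁⟩
  have hsin : 0 < Real.sin ψ := Real.sin_pos_of_pos_of_lt_pi hψ₀ (by linarith)
  obtain ⟨c, hc, hcmin⟩ := exists_between (lt_min hcos hsin)
  obtain ⟨hc_cos, hc_sin⟩ := lt_min_iff.1 hcmin
  have hre := eventually_mul_norm_le_of_tendsto_div_norm htangent (-Complex.reCLM) (c := c)
    (by simpa [Complex.exp_ofReal_mul_I_re, -Complex.ofReal_sub] using hc_cos)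
  have him := eventually_mul_norm_le_of_tendsto_div_norm htangent Complex.imCLM (c := c)
    (by simpa [Complex.exp_ofReal_mul_I_im, -Complex.ofReal_sub] using hc_sin)
  refine ⟨c / 2, half_pos hc, ?_⟩
  filter_upwards [hre,
    h.eventually_mul_norm_le _ (half_pos hc).le (half_lt_self hc) hre,
    h.eventually_mul_norm_le _ (half_pos hc).le (half_lt_self hc) him,
    h.upper_end.eventually_gt_atTop 0] with x hderiv hγre hγim hnorm
  refine ⟨?_, hγre, (mul_pos (half_pos hc) hnorm).trans_le hγim⟩
  exact (mul_le_mul_of_nonneg_right (half_le_self hc.le) (norm_nonneg _)).trans hderiv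

theorem IsContour.lower_estimates (h₁ : θ ≤ Real.pi / 2) (h : IsContour θ γ) :
    ∃ c > 0, ∀ᶠ x in atTop, c * ‖γ (-x)‖ ≤ -(γ (-x)).re ∧ (γ (-x)).im < 0 := by
  obtain ⟨c, hc, hx⟩ := (h.reflect h₁).upper_estimates
  exact ⟨c, hc, hx.mono fun x hx => by simpa [FracEvol.reflect] using hx.2⟩

theorem IsContour.exists_norm_ge (h : IsContour θ γ) : ∃ δ > 0, ∀ x, δ ≤ ‖γ x‖ := by
  have hproper : Tendsto (fun x => ‖γ x‖) (cocompact ℝ) atTop := by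
    rw [cocompact_eq_atBot_atTop]
    exact h.lower_end.sup h.upper_end
  obtain ⟨x₀, hx₀⟩ := h.continuous.norm.exists_forall_le hproper
  exact ⟨‖γ x₀‖, norm_pos_iff.2 (h.mem_sector x₀).1, hx₀⟩

theorem IsContour.tendsto_exp_mul_re (h : IsContour θ γ) {t : ℝ} (ht : 0 < t) :
    Tendsto (fun x => Real.exp (t * (γ x).re)) atTop (𝓝 0) := by
  obtain ⟨c, hc, hx⟩ := h.upper_estimates
  refine Real.tendsto_exp_atBot.comp ?_
  refine tendsto_atBot_mono' _ ?_
    (tendsto_neg_atTop_atBot.comp (h.upper_end.const_mul_atTop (mul_pos ht hc)))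
  filter_upwards [hx] with x hx
  simp only [Function.comp_apply]
  linarith [mul_le_mul_of_nonneg_left hx.2.1 ht.le]

theorem IsContour.integrableAtFilter_atTop (h : IsContour θ γ) {t : ℝ} (ht : 0 < t) :
    IntegrableAtFilter (fun x => Real.exp (t * (γ x).re) * ‖deriv γ x‖) atTop := by
  obtain ⟨c, hc, hest⟩ := h.upper_estimates
  obtain ⟨a, ha⟩ := eventually_atTop.1 (hest.and h.eventually_differentiableAt)
  have hre : ∀ x ∈ Ici a, c * ‖deriv γ x‖ ≤ -(deriv γ x).re := fun x hx => (ha x hx).1.1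
  have hderiv : ∀ x ∈ Ici a, HasDerivAt (fun x => Real.exp (t * (γ x).re))
      (Real.exp (t * (γ x).re) * (t * (deriv γ x).re)) x := fun x hx =>
    ((Complex.reCLM.hasFDerivAt.comp_hasDerivAt x (ha x hx).2.hasDerivAt).const_mul t).exp
  have hint := integrableOn_Ioi_deriv_of_nonpos' hderiv (fun x hx => ?_) (h.tendsto_exp_mul_re ht)
  · refine ⟨Ioi a, Ioi_mem_atTop a, (hint.norm.const_mul (1 / (t * c))).mono' ?_ ?_⟩
    · have := h.continuous
      have := measurable_deriv γ
      fun_prop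
    · refine (ae_restrict_iff' measurableSet_Ioi).2 (ae_of_all _ fun x hx => ?_)
      have hle : ‖deriv γ x‖ ≤ |(deriv γ x).re| / c := by
        rw [le_div_iff₀' hc]
        exact (hre x hx.out.le).trans (neg_le_abs _)
      calc ‖Real.exp (t * (γ x).re) * ‖deriv γ x‖‖
          ≤ Real.exp (t * (γ x).re) * (|(deriv γ x).re| / c) := by
            rw [norm_mul, norm_norm, Real.norm_eq_abs, Real.abs_exp]; gcongr
        _ = 1 / (t * c) * ‖Real.exp (t * (γ x).re) * (t * (deriv γ x).re)‖ := by
            simp only [norm_mul, Real.norm_eq_abs, Real.abs_exp, abs_of_pos ht]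
            field_simp
  · have hneg : (deriv γ x).re ≤ 0 := by
      linarith [hre x hx.out.le, mul_nonneg hc.le (norm_nonneg (deriv γ x))]
    exact mul_nonpos_of_nonneg_of_nonpos (Real.exp_pos _).le
      (mul_nonpos_of_nonneg_of_nonpos ht.le hneg)

theorem IsContour.integrable_exp_mul_norm_deriv (h₁ : θ ≤ Real.pi / 2) (h : IsContour θ γ) {t : ℝ}
    (ht : 0 < t) : Integrable (fun x => Real.exp (t * (γ x).re) * ‖deriv γ x‖) := by
  refine integrable_iff_integrableAtFilter_atBot_atTop.2
    ⟨⟨?_, h.integrableAtFilter_atTop ht⟩, ?_⟩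
  · obtain ⟨U, hU, hi⟩ := (h.reflect h₁).integrableAtFilter_atTop ht
    refine ⟨Neg.neg ⁻¹' U, tendsto_neg_atBot_atTop hU, ?_⟩
    simpa [Function.comp_def, FracEvol.reflect, deriv_reflect] using
      ((Measure.measurePreserving_neg (volume : Measure ℝ)).integrableOn_comp_preimage
        (Homeomorph.neg ℝ).measurableEmbedding).2 hi
  · have hcont : Continuous fun x => Real.exp (t * (γ x).re) := by
      have := h.continuous
      fun_prop
    have hnorm : LocallyIntegrable fun x => ‖deriv γ x‖ := locallyIntegrableOn_univ.1
      (h.locallyIntegrable.locallyIntegrableOn univ).norm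
    exact hnorm.continuous_mul hcont

end Ends

/-- The contour consisting of two rays that start at `ε` and leave to infinity at the angles
`± (π / 2 + θ / 2)`, with the signed arc length from `ε` as parameter. -/
def wedge (θ ε x : ℝ) : ℂ :=
  ⟨ε - Real.sin (θ / 2) * |x|, Real.cos (θ / 2) * x⟩

section Wedge

variable {θ ε : ℝ}

theorem sin_half_pos (h₀ : 0 < θ) (h₁ : θ ≤ Real.pi / 2) : 0 < Real.sin (θ / 2) :=
  Real.sin_pos_of_pos_of_lt_pi (by linarith) (by linarith [Real.pi_pos])

theorem cos_half_pos (h₀ : 0 < θ) (h₁ : θ ≤ Real.pi / 2) : 0 < Real.cos (θ / 2) :=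
  Real.cos_pos_of_mem_Ioo ⟨by linarith [Real.pi_pos], by linarith [Real.pi_pos]⟩

theorem wedge_eq (θ ε x : ℝ) : wedge θ ε x =
    ((ε - Real.sin (θ / 2) * |x| : ℝ) : ℂ) + ((Real.cos (θ / 2) * x : ℝ) : ℂ) * Complex.I :=
  Complex.mk_eq_add_mul_I _ _

theorem wedge_neg (θ ε x : ℝ) : wedge θ ε (-x) = (starRingEnd ℂ) (wedge θ ε x) := by
  apply Complex.ext <;> simp [wedge]

theorem wedge_of_nonneg (θ ε : ℝ) {x : ℝ} (hx : 0 ≤ x) :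
    wedge θ ε x = ε + x * Complex.exp ((Real.pi / 2 + θ / 2 : ℝ) * Complex.I) := by
  apply Complex.ext <;>
    simp only [wedge, Complex.add_re, Complex.add_im, Complex.re_ofReal_mul, Complex.im_ofReal_mul,
      Complex.exp_ofReal_mul_I_re, Complex.exp_ofReal_mul_I_im, Complex.ofReal_re,
      Complex.ofReal_im, abs_of_nonneg hx, add_comm (Real.pi / 2), Real.cos_add_pi_div_two,
      Real.sin_add_pi_div_two] <;> ring

theorem wedge_of_nonpos (θ ε : ℝ) {x : ℝ} (hx : x ≤ 0) :
    wedge θ ε x = ε + x * -Complex.exp (-(Real.pi / 2 + θ / 2 : ℝ) * Complex.I) := by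
  rw [← neg_neg x, wedge_neg, wedge_of_nonneg θ ε (neg_nonneg.2 hx)]
  rw [map_add, map_mul, Complex.conj_ofReal, Complex.conj_ofReal, conj_exp_ofReal_mul_I,
    Complex.ofReal_neg, neg_mul_comm, neg_neg]

theorem wedge_smul (θ ε x : ℝ) {r : ℝ} (hr : 0 ≤ r) :
    wedge θ (r * ε) (r * x) = r * wedge θ ε x := by
  apply Complex.ext
  · simp [wedge, abs_mul, abs_of_nonneg hr]; ring
  · simp [wedge]; ring

theorem continuous_wedge : Continuous (wedge θ ε) := by
  rw [funext (wedge_eq θ ε)]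
  fun_prop

theorem hasDerivAt_wedge_of_pos {x : ℝ} (hx : 0 < x) :
    HasDerivAt (wedge θ ε) (Complex.exp ((Real.pi / 2 + θ / 2 : ℝ) * Complex.I)) x := by
  have hline := ((Complex.ofRealCLM.hasDerivAt (x := x)).mul_const
    (Complex.exp ((Real.pi / 2 + θ / 2 : ℝ) * Complex.I))).const_add (ε : ℂ)
  simp only [Complex.ofRealCLM_apply, Complex.ofReal_one, one_mul] at hline
  exact hline.congr_of_eventuallyEq ((lt_mem_nhds hx).mono fun y hy => wedge_of_nonneg θ ε hy.le)

theorem hasDerivAt_wedge_of_neg {x : ℝ} (hx : x < 0) :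
    HasDerivAt (wedge θ ε) (-Complex.exp (-(Real.pi / 2 + θ / 2 : ℝ) * Complex.I)) x := by
  have hline := ((Complex.ofRealCLM.hasDerivAt (x := x)).mul_const
    (-Complex.exp (-(Real.pi / 2 + θ / 2 : ℝ) * Complex.I))).const_add (ε : ℂ)
  simp only [Complex.ofRealCLM_apply, Complex.ofReal_one, one_mul] at hline
  exact hline.congr_of_eventuallyEq ((gt_mem_nhds hx).mono fun y hy => wedge_of_nonpos θ ε hy.le)

theorem norm_deriv_wedge {x : ℝ} (hx : x ≠ 0) : ‖deriv (wedge θ ε) x‖ = 1 := by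
  rcases hx.lt_or_gt with hx | hx
  · rw [(hasDerivAt_wedge_of_neg hx).deriv, norm_neg, ← Complex.ofReal_neg,
      Complex.norm_exp_ofReal_mul_I]
  · rw [(hasDerivAt_wedge_of_pos hx).deriv, Complex.norm_exp_ofReal_mul_I]

theorem ae_norm_deriv_wedge (θ ε : ℝ) : ∀ᵐ x : ℝ, ‖deriv (wedge θ ε) x‖ = 1 := by
  filter_upwards [compl_mem_ae_iff.2 (measure_singleton (0 : ℝ))] with x hx
  exact norm_deriv_wedge hx

theorem continuousOn_deriv_wedge : ContinuousOn (deriv (wedge θ ε)) {0}ᶜ := fun x hx => by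
  refine ContinuousAt.continuousWithinAt ?_
  rcases (show x ≠ 0 from hx).lt_or_gt with hx | hx
  · exact continuousAt_const.congr
      ((gt_mem_nhds hx).mono fun y hy => (hasDerivAt_wedge_of_neg hy).deriv.symm)
  · exact continuousAt_const.congr
      ((lt_mem_nhds hx).mono fun y hy => (hasDerivAt_wedge_of_pos hy).deriv.symm)

theorem wedge_re_le (h₀ : 0 < θ) (h₁ : θ ≤ Real.pi / 2) (ε x : ℝ) : (wedge θ ε x).re ≤ ε :=
  sub_le_self _ (mul_nonneg (sin_half_pos h₀ h₁).le (abs_nonneg x))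

theorem norm_wedge_le (hε : 0 ≤ ε) (x : ℝ) : ‖wedge θ ε x‖ ≤ ε + |x| := by
  rcases le_total 0 x with hx | hx
  · rw [wedge_of_nonneg θ ε hx]
    refine (norm_add_le _ _).trans (le_of_eq ?_)
    rw [norm_mul, Complex.norm_exp_ofReal_mul_I, Complex.norm_real, Complex.norm_real, mul_one,
      Real.norm_of_nonneg hε, Real.norm_eq_abs]
  · rw [wedge_of_nonpos θ ε hx]
    refine (norm_add_le _ _).trans (le_of_eq ?_)
    rw [norm_mul, norm_neg, ← Complex.ofReal_neg, Complex.norm_exp_ofReal_mul_I, Complex.norm_real,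
      Complex.norm_real, mul_one, Real.norm_of_nonneg hε, Real.norm_eq_abs]

theorem cos_half_mul_abs_le_norm_wedge (h₀ : 0 < θ) (h₁ : θ ≤ Real.pi / 2) (x : ℝ) :
    Real.cos (θ / 2) * |x| ≤ ‖wedge θ ε x‖ := by
  refine le_trans (le_of_eq ?_) (Complex.abs_im_le_norm _)
  rw [wedge, abs_mul, abs_of_pos (cos_half_pos h₀ h₁)]

theorem cos_half_mul_le_norm_wedge (h₀ : 0 < θ) (h₁ : θ ≤ Real.pi / 2) (x : ℝ) :
    Real.cos (θ / 2) * ε ≤ ‖wedge θ ε x‖ := by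
  -- `cos (θ / 2) * ε` is the component of `wedge θ ε x` normal to the ray it lies on.
  have hnormal : Real.cos (θ / 2) * ε =
      Real.cos (θ / 2) * (wedge θ ε x).re + Real.sin (θ / 2) * |(wedge θ ε x).im| := by
    simp only [wedge, abs_mul, abs_of_pos (cos_half_pos h₀ h₁)]
    ring
  refine le_of_sq_le_sq ?_ (norm_nonneg _)
  rw [hnormal, ← Complex.normSq_eq_norm_sq, Complex.normSq_apply]
  nlinarith [sq_nonneg
      (Real.sin (θ / 2) * (wedge θ ε x).re - Real.cos (θ / 2) * |(wedge θ ε x).im|),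
    Real.sin_sq_add_cos_sq (θ / 2), sq_abs (wedge θ ε x).im]

theorem tendsto_norm_wedge_atTop (h₀ : 0 < θ) (h₁ : θ ≤ Real.pi / 2) (ε : ℝ) :
    Tendsto (fun x => ‖wedge θ ε x‖) atTop atTop :=
  tendsto_atTop_mono (cos_half_mul_abs_le_norm_wedge h₀ h₁)
    (tendsto_abs_atTop_atTop.const_mul_atTop (cos_half_pos h₀ h₁))

theorem tendsto_norm_wedge_atBot (h₀ : 0 < θ) (h₁ : θ ≤ Real.pi / 2) (ε : ℝ) :
    Tendsto (fun x => ‖wedge θ ε x‖) atBot atTop :=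
  tendsto_atTop_mono (cos_half_mul_abs_le_norm_wedge h₀ h₁)
    (tendsto_abs_atBot_atTop.const_mul_atTop (cos_half_pos h₀ h₁))

theorem wedge_mem_sector (h₀ : 0 < θ) (h₁ : θ ≤ Real.pi / 2) (hε : 0 < ε) (x : ℝ) :
    wedge θ ε x ∈ sector θ := by
  rw [mem_sector_iff h₀ h₁]
  rcases eq_or_ne x 0 with rfl | hx
  · left; simpa [wedge] using hε
  · right
    have hsin : Real.sin (θ / 2) =
        Real.sin θ * Real.cos (θ / 2) - Real.cos θ * Real.sin (θ / 2) := by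
      rw [← Real.sin_sub]; congr 1; ring
    have heq : (wedge θ ε x).re * Real.cos θ + |(wedge θ ε x).im| * Real.sin θ
        = ε * Real.cos θ + |x| * Real.sin (θ / 2) := by
      simp only [wedge, abs_mul, abs_of_pos (cos_half_pos h₀ h₁)]
      linear_combination |x| * (-hsin)
    rw [heq]
    have hcos : 0 ≤ Real.cos θ := Real.cos_nonneg_of_mem_Icc ⟨by linarith, h₁⟩
    have := mul_pos (abs_pos.2 hx) (sin_half_pos h₀ h₁)
    positivity

theorem isContour_wedge (h₀ : 0 < θ) (h₁ : θ ≤ Real.pi / 2) (hε : 0 < ε) :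
    IsContour θ (wedge θ ε) := by
  have hangle : (Real.pi / 2 + θ / 2 : ℝ) = Real.pi - (Real.pi / 2 - θ / 2) := by ring
  refine ⟨continuous_wedge, ⟨{0}, fun x hx => ?_, by simpa using continuousOn_deriv_wedge⟩, ?_,
    wedge_mem_sector h₀ h₁ hε, tendsto_norm_wedge_atBot h₀ h₁ ε, tendsto_norm_wedge_atTop h₀ h₁ ε,
    ⟨Real.pi / 2 - θ / 2, by linarith [Real.pi_pos], by linarith, ?_⟩,
    ⟨Real.pi / 2 - θ / 2, by linarith [Real.pi_pos], by linarith, ?_⟩⟩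
  · rcases (show x ≠ 0 by simpa using hx).lt_or_gt with hx | hx
    · exact (hasDerivAt_wedge_of_neg hx).differentiableAt
    · exact (hasDerivAt_wedge_of_pos hx).differentiableAt
  · refine (locallyIntegrable_const (1 : ℝ)).mono (measurable_deriv _).aestronglyMeasurable ?_
    filter_upwards [ae_norm_deriv_wedge θ ε] with x hx
    rw [hx, norm_one]
  · refine tendsto_const_nhds.congr' ?_
    filter_upwards [eventually_lt_atBot 0] with x hx
    rw [norm_deriv_wedge hx.ne, (hasDerivAt_wedge_of_neg hx).deriv, Complex.ofReal_one, div_one,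
      hangle]
  · refine tendsto_const_nhds.congr' ?_
    filter_upwards [eventually_gt_atTop 0] with x hx
    rw [norm_deriv_wedge hx.ne', (hasDerivAt_wedge_of_pos hx).deriv, Complex.ofReal_one, div_one,
      hangle]

theorem integrable_exp_wedge_re (h₀ : 0 < θ) (h₁ : θ ≤ Real.pi / 2) {t : ℝ} (hε : 0 < ε)
    (ht : 0 < t) : Integrable (fun x => Real.exp (t * (wedge θ ε x).re)) := by
  refine ((isContour_wedge h₀ h₁ hε).integrable_exp_mul_norm_deriv h₁ ht).congr ?_
  filter_upwards [ae_norm_deriv_wedge θ ε] with x hx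
  rw [hx, mul_one]

theorem integral_exp_wedge_re_inv (θ : ℝ) {t : ℝ} (ht : 0 < t) :
    ∫ x, Real.exp (t * (wedge θ t⁻¹ x).re) = t⁻¹ * ∫ x, Real.exp (wedge θ 1 x).re := by
  have hscale := Measure.integral_comp_mul_left (fun x => Real.exp (wedge θ 1 x).re) t
  rw [abs_of_pos (inv_pos.2 ht), smul_eq_mul] at hscale
  rw [← hscale]
  congr 1 with x
  rw [← Complex.re_ofReal_mul, ← wedge_smul θ _ x ht.le, mul_inv_cancel₀ ht.ne']

end Wedge

/-! ### Contour integrals of inverse Laplace transforms -/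

section InverseLaplace

variable {E : Type*} [NormedAddCommGroup E] [NormedSpace ℂ E]

/-- `L` is holomorphic on the sector of angle `θ` and bounded there by `C |z| ^ (-α)`. -/
structure HasDecay (L : ℂ → E) (θ α C : ℝ) : Prop where
  angle_pos : 0 < θ
  angle_le : θ ≤ Real.pi / 2
  exponent_pos : 0 < α
  const_nonneg : 0 ≤ C
  differentiableOn : DifferentiableOn ℂ L (sector θ)
  bound : ∀ z ∈ sector θ, ‖L z‖ ≤ C * ‖z‖ ^ (-α)

/-- The integrand of the inverse Laplace transform of `L` along `γ`. -/
def laplaceIntegrand (L : ℂ → E) (γ : ℝ → ℂ) (t x : ℝ) : E :=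
  (Complex.exp (γ x * (t : ℂ)) * deriv γ x) • L (γ x)

/-- The inverse Laplace transform of `L` along `γ`; the kernel `P_α` is the case
`L z = (z ^ α - A)⁻¹`. -/
def invLaplace (L : ℂ → E) (γ : ℝ → ℂ) (t : ℝ) : E :=
  (1 / (2 * (Real.pi : ℂ) * Complex.I)) • ∫ x : ℝ, laplaceIntegrand L γ t x

variable {L : ℂ → E} {θ α C : ℝ} {γ : ℝ → ℂ}

theorem norm_exp_mul_ofReal (z : ℂ) (t : ℝ) :
    ‖Complex.exp (z * (t : ℂ))‖ = Real.exp (t * z.re) := by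
  rw [Complex.norm_exp, Complex.re_mul_ofReal, mul_comm]

theorem norm_laplaceIntegrand (L : ℂ → E) (γ : ℝ → ℂ) (t x : ℝ) :
    ‖laplaceIntegrand L γ t x‖ = Real.exp (t * (γ x).re) * ‖deriv γ x‖ * ‖L (γ x)‖ := by
  rw [laplaceIntegrand, norm_smul, norm_mul, norm_exp_mul_ofReal]

namespace HasDecay

theorem bound_of_le_norm (hL : HasDecay L θ α C) {m : ℝ} (hm : 0 < m) {z : ℂ}
    (hz : z ∈ sector θ) (hmz : m ≤ ‖z‖) : ‖L z‖ ≤ C * m ^ (-α) :=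
  (hL.bound z hz).trans (mul_le_mul_of_nonneg_left
    (Real.rpow_le_rpow_of_nonpos hm hmz (neg_nonpos.2 hL.exponent_pos.le)) hL.const_nonneg)

theorem continuous_comp (hL : HasDecay L θ α C) (hγ : IsContour θ γ) :
    Continuous fun x => L (γ x) :=
  hL.differentiableOn.continuousOn.comp_continuous hγ.continuous hγ.mem_sector

theorem aestronglyMeasurable (hL : HasDecay L θ α C) (hγ : IsContour θ γ) (t : ℝ) :
    AEStronglyMeasurable (laplaceIntegrand L γ t) := by
  have hexp : Continuous fun x => Complex.exp (γ x * (t : ℂ)) :=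
    Complex.continuous_exp.comp (hγ.continuous.mul continuous_const)
  exact (hexp.aestronglyMeasurable.mul (measurable_deriv γ).aestronglyMeasurable).smul
    (hL.continuous_comp hγ).aestronglyMeasurable

theorem exists_norm_comp_le (hL : HasDecay L θ α C) (hγ : IsContour θ γ) :
    ∃ M, ∀ x, ‖L (γ x)‖ ≤ M :=
  let ⟨δ, hδ, h⟩ := hγ.exists_norm_ge
  ⟨C * δ ^ (-α), fun x => hL.bound_of_le_norm hδ (hγ.mem_sector x) (h x)⟩

theorem integrable (hL : HasDecay L θ α C) (hγ : IsContour θ γ) {t : ℝ} (ht : 0 < t) :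
    Integrable (laplaceIntegrand L γ t) := by
  obtain ⟨M, hM⟩ := hL.exists_norm_comp_le hγ
  refine ((hγ.integrable_exp_mul_norm_deriv hL.angle_le ht).mul_const M).mono'
    (hL.aestronglyMeasurable hγ t) (ae_of_all _ fun x => ?_)
  rw [norm_laplaceIntegrand]
  gcongr
  exact hM x

theorem continuousAt_invLaplace (hL : HasDecay L θ α C) (hγ : IsContour θ γ) {t : ℝ}
    (ht : 0 < t) : ContinuousAt (invLaplace L γ) t := by
  obtain ⟨M, hM⟩ := hL.exists_norm_comp_le hγ
  have hexp : ∀ {s r : ℝ}, s ∈ Icc (t / 2) (2 * t) →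
      Real.exp (s * r) ≤ Real.exp (t / 2 * r) + Real.exp (2 * t * r) := by
    intro s r hs
    rcases le_total 0 r with h | h
    · exact (Real.exp_le_exp.2 (mul_le_mul_of_nonneg_right hs.2 h)).trans
        (le_add_of_nonneg_left (Real.exp_pos _).le)
    · exact (Real.exp_le_exp.2 (mul_le_mul_of_nonpos_right hs.1 h)).trans
        (le_add_of_nonneg_right (Real.exp_pos _).le)
  refine ContinuousAt.const_smul (continuousAt_of_dominated
    (bound := fun x => (Real.exp (t / 2 * (γ x).re) * ‖deriv γ x‖ +
      Real.exp (2 * t * (γ x).re) * ‖deriv γ x‖) * M)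
    (Eventually.of_forall fun s => hL.aestronglyMeasurable hγ s) ?_
    (((hγ.integrable_exp_mul_norm_deriv hL.angle_le (half_pos ht)).add
      (hγ.integrable_exp_mul_norm_deriv hL.angle_le (mul_pos two_pos ht))).mul_const M) ?_) _
  · filter_upwards [Icc_mem_nhds (half_lt_self ht) (lt_two_mul_self ht)] with s hs
    refine ae_of_all _ fun x => ?_
    rw [norm_laplaceIntegrand, ← add_mul]
    gcongr
    · exact hexp hs
    · exact hM x
  · refine ae_of_all _ fun x => ContinuousAt.smul (Continuous.continuousAt ?_) continuousAt_const
    fun_prop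

end HasDecay

theorem IsContour.integral_eq_sub [CompleteSpace E] {F G : ℂ → E} (hγ : IsContour θ γ)
    {U : Set ℂ} (hU : ∀ x, γ x ∈ U) (hG : ∀ z ∈ U, HasDerivAt G (F z) z)
    (hF : ContinuousOn F U) (a b : ℝ) :
    ∫ x in a..b, deriv γ x • F (γ x) = G (γ b) - G (γ a) := by
  obtain ⟨S, hS, -⟩ := hγ.piecewise_c1
  refine integral_eq_of_hasDerivAt_off_countable (fun x => G (γ x)) _ S.countable_toSet ?_
    (fun x hx => (hG _ (hU x)).scomp x (hS x hx.2).hasDerivAt)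
    ((hγ.intervalIntegrable_deriv a b).smul_continuousOn
      (hF.comp_continuous hγ.continuous hU).continuousOn)
  exact (ContinuousOn.comp_continuous (s := U)
    (fun z hz => (hG z hz).continuousAt.continuousWithinAt) hγ.continuous hU).continuousOn

theorem convex_sector_inter_halfPlane (h₀ : 0 < θ) (h₁ : θ ≤ Real.pi / 2) {σ : ℝ}
    (hσ : |σ| = 1) : Convex ℝ (sector θ ∩ {z | 0 < σ * z.im}) := by
  have hcos : 0 ≤ Real.cos θ := Real.cos_nonneg_of_mem_Icc ⟨by linarith, h₁⟩
  have hsin : 0 < Real.sin θ := Real.sin_pos_of_pos_of_lt_pi h₀ (by linarith [Real.pi_pos])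
  have heq : sector θ ∩ {z | 0 < σ * z.im} =
      {z | 0 < z.re * Real.cos θ + σ * z.im * Real.sin θ} ∩ {z | 0 < σ * z.im} := by
    ext z
    refine and_congr_left fun hz : 0 < σ * z.im => ?_
    have habs : |z.im| = σ * z.im := by rw [← abs_of_pos hz, abs_mul, hσ, one_mul]
    rw [mem_sector_iff h₀ h₁, habs]
    refine or_iff_right_of_imp fun hre => ?_
    positivity
  rw [heq]
  exact (convex_halfSpace_gt (f := fun z : ℂ => z.re * Real.cos θ + σ * z.im * Real.sin θ)
    ⟨fun x y => by simp; ring, fun a x => by simp; ring⟩ 0).inter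
    (convex_halfSpace_gt (σ • Complex.imLm).isLinear 0)

theorem HasDecay.norm_primitive_sub_le (hL : HasDecay L θ α C) {t : ℝ} (ht : 0 < t) {G : ℂ → E}
    (hG : ∀ z ∈ sector θ, HasDerivAt G (Complex.exp (z * (t : ℂ)) • L z) z) {σ m : ℝ}
    (hσ : |σ| = 1) (hm : 0 < m) {z w : ℂ} (hz : z ∈ sector θ) (hw : w ∈ sector θ)
    (hzi : 0 < σ * z.im) (hwi : 0 < σ * w.im) (hzr : z.re ≤ -m) (hwr : w.re ≤ -m) :
    ‖G z - G w‖ ≤ C * m ^ (-α) * Real.exp (-(t * m)) * ‖z - w‖ := by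
  refine ((convex_sector_inter_halfPlane hL.angle_pos hL.angle_le hσ).inter
    (convex_halfSpace_re_le (-m))).norm_image_sub_le_of_norm_hasDerivWithin_le
    (fun ζ hζ => (hG ζ hζ.1.1).hasDerivWithinAt) (fun ζ hζ => ?_)
    ⟨⟨hw, hwi⟩, hwr⟩ ⟨⟨hz, hzi⟩, hzr⟩
  have hre : ζ.re ≤ -m := hζ.2
  have hnorm : m ≤ ‖ζ‖ :=
    (le_neg_of_le_neg hre).trans ((neg_le_abs _).trans (Complex.abs_re_le_norm _))
  have hexp : Real.exp (t * ζ.re) ≤ Real.exp (-(t * m)) := by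
    rw [← mul_neg]; gcongr
  rw [norm_smul, norm_exp_mul_ofReal, mul_comm]
  exact mul_le_mul (hL.bound_of_le_norm hm hζ.1.1 hnorm) hexp (Real.exp_pos _).le
    (mul_nonneg hL.const_nonneg (by positivity))

theorem wedge_re_le_neg_mul (h₀ : 0 < θ) (h₁ : θ ≤ Real.pi / 2) {ε x : ℝ}
    (hx : 2 * ε / Real.sin (θ / 2) ≤ |x|) : (wedge θ ε x).re ≤ -(Real.sin (θ / 2) / 2 * |x|) := by
  rw [div_le_iff₀ (sin_half_pos h₀ h₁)] at hx
  simp only [wedge]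
  linarith

theorem tendsto_affine_mul_exp_neg_mul (a b : ℝ) {k : ℝ} (hk : 0 < k) :
    Tendsto (fun r : ℝ => (a + b * r) * Real.exp (-(k * r))) atTop (𝓝 0) := by
  have hlinear := (tendsto_rpow_mul_exp_neg_mul_atTop_nhds_zero 1 k hk).const_mul b
  have hconst := (tendsto_rpow_mul_exp_neg_mul_atTop_nhds_zero 0 k hk).const_mul a
  simpa [add_mul, mul_assoc] using hconst.add hlinear

theorem HasDecay.tendsto_primitive_sub (hL : HasDecay L θ α C) {t : ℝ} (ht : 0 < t) {G : ℂ → E}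
    (hG : ∀ z ∈ sector θ, HasDerivAt G (Complex.exp (z * (t : ℂ)) • L z) z) {σ c ε : ℝ}
    (hσ : |σ| = 1) (hc : 0 < c) (hε : 0 < ε) {z : ℝ → ℂ} (hz : ∀ x, z x ∈ sector θ)
    (hn : Tendsto (fun x => ‖z x‖) atTop atTop)
    (hi : ∀ᶠ x in atTop, c * ‖z x‖ ≤ -(z x).re ∧ 0 < σ * (z x).im) :
    Tendsto (fun x => G (z x) - G (wedge θ ε (σ * ‖z x‖))) atTop (𝓝 0) := by
  have hsin := sin_half_pos hL.angle_pos hL.angle_le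
  have hcos := cos_half_pos hL.angle_pos hL.angle_le
  have hC := hL.const_nonneg
  -- Far out both points lie in the half plane `re ≤ -k r`, where `r` is the modulus of `z x`.
  obtain ⟨k, hk, hkc, hks⟩ : ∃ k, 0 < k ∧ k ≤ c ∧ k ≤ Real.sin (θ / 2) / 2 :=
    ⟨min c (Real.sin (θ / 2) / 2), lt_min hc (half_pos hsin), min_le_left _ _, min_le_right _ _⟩
  have hlim := ((tendsto_affine_mul_exp_neg_mul ε 2 (mul_pos ht hk)).const_mul C).comp hn
  rw [mul_zero] at hlim
  refine squeeze_zero_norm' ?_ hlim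
  filter_upwards [hi, hn.eventually_ge_atTop (2 * ε / Real.sin (θ / 2)),
    hn.eventually_ge_atTop (1 / k)] with x hx hxε hxk
  set r := ‖z x‖
  have hkr : 1 ≤ k * r := by rwa [div_le_iff₀' hk] at hxk
  have hr : 0 < r := lt_of_lt_of_le (one_div_pos.2 hk) hxk
  have habs : |σ * r| = r := by rw [abs_mul, hσ, one_mul, abs_of_pos hr]
  have hwedge_im : σ * (wedge θ ε (σ * r)).im = Real.cos (θ / 2) * r := by
    calc σ * (Real.cos (θ / 2) * (σ * r)) = |σ| * |σ| * (Real.cos (θ / 2) * r) := by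
          rw [abs_mul_abs_self]; ring
      _ = Real.cos (θ / 2) * r := by rw [hσ]; ring
  have hwedge_re : (wedge θ ε (σ * r)).re ≤ -(k * r) := by
    have hfar := wedge_re_le_neg_mul hL.angle_pos hL.angle_le (habs.symm ▸ hxε)
    rw [habs] at hfar
    exact hfar.trans (neg_le_neg (mul_le_mul_of_nonneg_right hks hr.le))
  have hdist : ‖z x - wedge θ ε (σ * r)‖ ≤ ε + 2 * r := by
    have hwedge := norm_wedge_le (θ := θ) hε.le (σ * r)
    rw [habs] at hwedge
    linarith [norm_sub_le (z x) (wedge θ ε (σ * r))]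
  have hpow : (k * r) ^ (-α) ≤ 1 :=
    Real.rpow_le_one_of_one_le_of_nonpos hkr (neg_nonpos.2 hL.exponent_pos.le)
  calc ‖G (z x) - G (wedge θ ε (σ * r))‖
      ≤ C * (k * r) ^ (-α) * Real.exp (-(t * (k * r))) * ‖z x - wedge θ ε (σ * r)‖ :=
        hL.norm_primitive_sub_le ht hG hσ (by positivity) (hz x)
          (wedge_mem_sector hL.angle_pos hL.angle_le hε _) hx.2
          (hwedge_im.symm ▸ by positivity)
          (by linarith [hx.1, mul_le_mul_of_nonneg_right hkc hr.le]) hwedge_re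
    _ ≤ C * 1 * Real.exp (-(t * (k * r))) * (ε + 2 * r) := by gcongr
    _ = C * ((ε + 2 * r) * Real.exp (-(t * k * r))) := by rw [mul_assoc t]; ring

theorem HasDecay.intervalIntegral_laplaceIntegrand [CompleteSpace E] (hL : HasDecay L θ α C)
    (hγ : IsContour θ γ) {t : ℝ} {G : ℂ → E}
    (hG : ∀ z ∈ sector θ, HasDerivAt G (Complex.exp (z * (t : ℂ)) • L z) z) (a b : ℝ) :
    ∫ x in a..b, laplaceIntegrand L γ t x = G (γ b) - G (γ a) := by
  have hF : ContinuousOn (fun z => Complex.exp (z * (t : ℂ)) • L z) (sector θ) :=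
    ContinuousOn.smul (by fun_prop) hL.differentiableOn.continuousOn
  rw [← hγ.integral_eq_sub hγ.mem_sector hG hF]
  refine intervalIntegral.integral_congr fun x _ => ?_
  simp only [laplaceIntegrand, smul_smul, mul_comm]

theorem HasDecay.integral_eq_wedge [CompleteSpace E] (hL : HasDecay L θ α C) (hγ : IsContour θ γ)
    {t ε : ℝ} (ht : 0 < t) (hε : 0 < ε) :
    ∫ x, laplaceIntegrand L γ t x = ∫ x, laplaceIntegrand L (wedge θ ε) t x := by
  have hw := isContour_wedge hL.angle_pos hL.angle_le hε
  obtain ⟨G, hG⟩ := exists_primitive_sector hL.angle_le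
    (show DifferentiableOn ℂ (fun z => Complex.exp (z * (t : ℂ)) • L z) (sector θ) from
      DifferentiableOn.smul (by fun_prop) hL.differentiableOn)
  have hlower : Tendsto (fun x => ‖γ (-x)‖) atTop atTop :=
    hγ.lower_end.comp tendsto_neg_atTop_atBot
  have hupper_sub : Tendsto (fun x => G (γ x) - G (wedge θ ε (1 * ‖γ x‖))) atTop (𝓝 0) := by
    obtain ⟨c, hc, h⟩ := hγ.upper_estimates
    exact hL.tendsto_primitive_sub ht hG abs_one hc hε hγ.mem_sector hγ.upper_end
      (h.mono fun x hx => ⟨hx.2.1, by simpa using hx.2.2⟩)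
  have hlower_sub : Tendsto (fun x => G (γ (-x)) - G (wedge θ ε (-1 * ‖γ (-x)‖))) atTop (𝓝 0) := by
    obtain ⟨c, hc, h⟩ := hγ.lower_estimates hL.angle_le
    exact hL.tendsto_primitive_sub ht hG (by simp) hc hε (fun x => hγ.mem_sector (-x)) hlower
      (h.mono fun x hx => ⟨hx.1, by simpa using hx.2⟩)
  have hwedge := intervalIntegral_tendsto_integral (hL.integrable hw ht)
    (tendsto_neg_atTop_atBot.comp hlower) hγ.upper_end
  have hγ_lim := hwedge.add (hupper_sub.sub hlower_sub)
  rw [sub_zero, add_zero] at hγ_lim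
  refine tendsto_nhds_unique (intervalIntegral_tendsto_integral (hL.integrable hγ ht)
    tendsto_neg_atTop_atBot tendsto_id) (hγ_lim.congr fun x => ?_)
  rw [hL.intervalIntegral_laplaceIntegrand hγ hG, hL.intervalIntegral_laplaceIntegrand hw hG]
  simp only [Function.comp, id, one_mul, neg_mul]
  abel

theorem HasDecay.invLaplace_eq_wedge [CompleteSpace E] (hL : HasDecay L θ α C)
    (hγ : IsContour θ γ) {t ε : ℝ} (ht : 0 < t) (hε : 0 < ε) :
    invLaplace L γ t = invLaplace L (wedge θ ε) t := by
  rw [invLaplace, invLaplace, hL.integral_eq_wedge hγ ht hε]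

theorem HasDecay.ae_norm_laplaceIntegrand_wedge_le (hL : HasDecay L θ α C) {ε : ℝ} (hε : 0 < ε)
    (t : ℝ) : ∀ᵐ x, ‖laplaceIntegrand L (wedge θ ε) t x‖ ≤
      Real.exp (t * (wedge θ ε x).re) * (C * (Real.cos (θ / 2) * ε) ^ (-α)) := by
  filter_upwards [ae_norm_deriv_wedge θ ε] with x hx
  rw [norm_laplaceIntegrand, hx, mul_one]
  exact mul_le_mul_of_nonneg_left (hL.bound_of_le_norm
    (mul_pos (cos_half_pos hL.angle_pos hL.angle_le) hε)
    (wedge_mem_sector hL.angle_pos hL.angle_le hε x)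
    (cos_half_mul_le_norm_wedge hL.angle_pos hL.angle_le x)) (Real.exp_pos _).le

theorem norm_one_div_two_pi_I : ‖1 / (2 * (Real.pi : ℂ) * Complex.I)‖ = (2 * Real.pi)⁻¹ := by
  simp [abs_of_pos Real.pi_pos]

theorem HasDecay.exists_norm_invLaplace_le [CompleteSpace E] (hL : HasDecay L θ α C)
    (hγ : IsContour θ γ) :
    ∃ M, ∀ t > 0, ‖invLaplace L γ t‖ ≤ M * t ^ (α - 1) := by
  have hcos := cos_half_pos hL.angle_pos hL.angle_le
  set J := ∫ x, Real.exp (wedge θ 1 x).re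
  refine ⟨(2 * Real.pi)⁻¹ * (J * (C * Real.cos (θ / 2) ^ (-α))), fun t ht => ?_⟩
  -- The wedge with vertex `t⁻¹` gives the right power of `t`.
  have hε : 0 < t⁻¹ := inv_pos.2 ht
  have hpow : t⁻¹ * (Real.cos (θ / 2) * t⁻¹) ^ (-α) = Real.cos (θ / 2) ^ (-α) * t ^ (α - 1) := by
    rw [Real.mul_rpow hcos.le hε.le, Real.inv_rpow ht.le, Real.rpow_neg ht.le, inv_inv,
      Real.rpow_sub_one ht.ne']
    ring
  calc ‖invLaplace L γ t‖
      = (2 * Real.pi)⁻¹ * ‖∫ x, laplaceIntegrand L (wedge θ t⁻¹) t x‖ := by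
        rw [hL.invLaplace_eq_wedge hγ ht hε, invLaplace, norm_smul, norm_one_div_two_pi_I]
    _ ≤ (2 * Real.pi)⁻¹ * (t⁻¹ * J * (C * (Real.cos (θ / 2) * t⁻¹) ^ (-α))) := by
        gcongr
        rw [← integral_exp_wedge_re_inv θ ht, ← integral_mul_const]
        exact norm_integral_le_of_norm_le
          ((integrable_exp_wedge_re hL.angle_pos hL.angle_le hε ht).mul_const _)
          (hL.ae_norm_laplaceIntegrand_wedge_le hε t)
    _ = (2 * Real.pi)⁻¹ * (J * (C * (t⁻¹ * (Real.cos (θ / 2) * t⁻¹) ^ (-α)))) := by ring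
    _ = (2 * Real.pi)⁻¹ * (J * (C * Real.cos (θ / 2) ^ (-α))) * t ^ (α - 1) := by rw [hpow]; ring

end InverseLaplace

/-! ### Cauchy's formula on a wedge -/

section LaplaceTransform

variable {E : Type*} [NormedAddCommGroup E] [NormedSpace ℂ E]
variable {L : ℂ → E} {θ α C ε : ℝ} {γ : ℝ → ℂ} {z : ℂ}

theorem norm_sub_conj_le_of_arc (h₁ : θ ≤ Real.pi / 2) {G N : ℂ → E}
    (hG : ∀ z ∈ sector θ, HasDerivAt G (N z) z) {w : ℂ} (hw : w ∈ sector θ) {K : ℝ}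
    (hN : ∀ z ∈ sector θ, ‖z‖ = ‖w‖ → ‖N z‖ ≤ K) :
    ‖G w - G ((starRingEnd ℂ) w)‖ ≤ ‖w‖ * K * (2 * Real.pi) := by
  have hr : 0 < ‖w‖ := norm_pos_iff.2 hw.1
  have hnorm : ∀ τ, ‖circleMap 0 ‖w‖ τ‖ = ‖w‖ := fun τ => by
    rw [norm_circleMap_zero, abs_of_pos hr]
  have hmem : ∀ τ ∈ Icc (-|w.arg|) |w.arg|, circleMap 0 ‖w‖ τ ∈ sector θ := fun τ hτ => by
    rw [circleMap_zero]
    exact polar_mem_sector h₁ hr (lt_of_le_of_lt (abs_le.2 hτ) hw.2)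
  have hderiv : ∀ τ ∈ Icc (-|w.arg|) |w.arg|, HasDerivWithinAt (fun τ => G (circleMap 0 ‖w‖ τ))
      ((circleMap 0 ‖w‖ τ * Complex.I) • N (circleMap 0 ‖w‖ τ)) (Icc (-|w.arg|) |w.arg|) τ :=
    fun τ hτ => ((hG _ (hmem τ hτ)).scomp τ (hasDerivAt_circleMap 0 ‖w‖ τ)).hasDerivWithinAt
  have hbound : ∀ τ ∈ Icc (-|w.arg|) |w.arg|,
      ‖(circleMap 0 ‖w‖ τ * Complex.I) • N (circleMap 0 ‖w‖ τ)‖ ≤ ‖w‖ * K := fun τ hτ => by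
    rw [norm_smul, norm_mul, hnorm, Complex.norm_I, mul_one]
    exact mul_le_mul_of_nonneg_left (hN _ (hmem τ hτ) (hnorm τ)) hr.le
  have harg : circleMap 0 ‖w‖ w.arg = w := by
    rw [circleMap_zero, Complex.norm_mul_exp_arg_mul_I]
  have hneg : circleMap 0 ‖w‖ (-w.arg) = (starRingEnd ℂ) w := by
    rw [circleMap_zero, Complex.ofReal_neg, ← conj_exp_ofReal_mul_I, ← Complex.conj_ofReal,
      ← map_mul, Complex.norm_mul_exp_arg_mul_I]
  have hmvt := (convex_Icc (-|w.arg|) |w.arg|).norm_image_sub_le_of_norm_hasDerivWithin_le hderiv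
    hbound (abs_le.1 (abs_neg w.arg).le) (abs_le.1 (le_refl |w.arg|))
  rw [harg, hneg, sub_neg_eq_add, ← two_mul, norm_mul, Real.norm_ofNat, Real.norm_eq_abs] at hmvt
  have hK : 0 ≤ K := (norm_nonneg _).trans (hN w hw rfl)
  exact hmvt.trans (by gcongr; exact Complex.abs_arg_le_pi w)

theorem tendsto_log_sub_log (z : ℂ) {w : ℝ → ℂ} (hw : Tendsto (fun x => ‖w x‖) atTop atTop)
    (hre : ∀ᶠ x in atTop, (w x).re < 0) :
    Tendsto (fun x => Complex.log (-w x) - Complex.log (z - w x)) atTop (𝓝 0) := by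
  have hone : Tendsto (fun x => 1 - z / w x) atTop (𝓝 1) := by
    have hzero : Tendsto (fun x => z / w x) atTop (𝓝 0) := by
      rw [tendsto_zero_iff_norm_tendsto_zero]
      simpa only [norm_div] using hw.const_div_atTop _
    simpa using hzero.const_sub 1
  have hlog : Tendsto (fun x => Complex.log (1 - z / w x)) atTop (𝓝 0) := by
    rw [← Complex.log_one]
    exact hone.clog Complex.one_mem_slitPlane
  have hone_re : ∀ᶠ x in atTop, 0 < (1 - z / w x).re :=
    ((Complex.continuous_re.tendsto _).comp hone).eventually_const_lt (by simp)
  rw [← neg_zero]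
  refine hlog.neg.congr' ?_
  filter_upwards [hre, hone_re] with x hx hx'
  have hw₀ : w x ≠ 0 := fun h => by simp [h] at hx
  have hone₀ : 1 - z / w x ≠ 0 := fun h => by simp [h] at hx'
  have hfactor : z - w x = -w x * (1 - z / w x) := by field_simp; ring
  have harg := abs_lt.1 (Complex.abs_arg_lt_pi_div_two_iff.2 (Or.inl (show 0 < (-w x).re by simpa)))
  have harg' := abs_lt.1 (Complex.abs_arg_lt_pi_div_two_iff.2 (Or.inl hx'))
  rw [hfactor, Complex.log_mul (neg_ne_zero.2 hw₀) hone₀ ⟨by linarith, by linarith⟩]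
  ring

theorem log_eq_log_neg_add {w : ℂ} (hw : 0 < w.im) :
    Complex.log w = Complex.log (-w) + Real.pi * Complex.I := by
  apply Complex.ext
  · simp [Complex.log_re]
  · simp [Complex.log_im, Complex.arg_neg_eq_arg_sub_pi_of_im_pos hw]

theorem log_eq_log_neg_sub {w : ℂ} (hw : w.im < 0) :
    Complex.log w = Complex.log (-w) - Real.pi * Complex.I := by
  apply Complex.ext
  · simp [Complex.log_re]
  · simp [Complex.log_im, Complex.arg_neg_eq_arg_add_pi_of_im_neg hw]

theorem tendsto_log_wedge (h₀ : 0 < θ) (h₁ : θ ≤ Real.pi / 2) (z : ℂ) (ε : ℝ) :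
    Tendsto (fun y => (Complex.log (wedge θ ε y) - Complex.log (z - wedge θ ε y)) -
      (Complex.log (wedge θ ε (-y)) - Complex.log (z - wedge θ ε (-y)))) atTop
      (𝓝 (2 * Real.pi * Complex.I)) := by
  have hre : ∀ᶠ y : ℝ in atTop, (wedge θ ε y).re < 0 := by
    filter_upwards [eventually_gt_atTop (0 : ℝ), eventually_ge_atTop (2 * ε / Real.sin (θ / 2))]
      with y hy hyε
    refine (wedge_re_le_neg_mul h₀ h₁ (hyε.trans (le_abs_self y))).trans_lt (neg_neg_of_pos ?_)
    exact mul_pos (half_pos (sin_half_pos h₀ h₁)) (abs_pos.2 hy.ne')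
  have hupper := tendsto_log_sub_log z (tendsto_norm_wedge_atTop h₀ h₁ ε) hre
  have hlower := tendsto_log_sub_log z (w := fun y => wedge θ ε (-y))
    ((tendsto_norm_wedge_atBot h₀ h₁ ε).comp tendsto_neg_atTop_atBot)
    (hre.mono fun y hy => by rwa [wedge_neg])
  have hsum := (hupper.sub hlower).add_const (2 * Real.pi * Complex.I)
  rw [sub_zero, zero_add] at hsum
  refine hsum.congr' ?_
  filter_upwards [eventually_gt_atTop 0] with y hy
  have him : 0 < (wedge θ ε y).im := mul_pos (cos_half_pos h₀ h₁) hy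
  have him' : (wedge θ ε (-y)).im < 0 := by rw [wedge_neg]; exact neg_neg_of_pos him
  rw [log_eq_log_neg_add him, log_eq_log_neg_sub him']
  ring

theorem exists_mul_one_add_abs_le {a b : ℝ} (ha : 0 < a) (hb : 0 < b) :
    ∃ k > 0, ∀ x, k * (1 + |x|) ≤ a + b * |x| :=
  ⟨min a b, lt_min ha hb, fun x => by
    rw [mul_one_add]
    exact add_le_add (min_le_left _ _) (mul_le_mul_of_nonneg_right (min_le_right _ _)
      (abs_nonneg x))⟩

theorem exists_mul_one_add_abs_le_norm_wedge (h₀ : 0 < θ) (h₁ : θ ≤ Real.pi / 2) (hε : 0 < ε) :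
    ∃ k > 0, ∀ x, k * (1 + |x|) ≤ ‖wedge θ ε x‖ := by
  have hcos := cos_half_pos h₀ h₁
  obtain ⟨k, hk, h⟩ := exists_mul_one_add_abs_le (mul_pos hcos hε) hcos
  refine ⟨k / 2, half_pos hk, fun x => ?_⟩
  linarith [h x, cos_half_mul_abs_le_norm_wedge (ε := ε) h₀ h₁ x,
    cos_half_mul_le_norm_wedge (ε := ε) h₀ h₁ x]

theorem sub_wedge_re (z : ℂ) (θ ε x : ℝ) :
    (z - wedge θ ε x).re = z.re - ε + Real.sin (θ / 2) * |x| := by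
  rw [Complex.sub_re, wedge, sub_sub_eq_add_sub]
  ring

theorem sub_wedge_re_pos (h₀ : 0 < θ) (h₁ : θ ≤ Real.pi / 2) (hz : ε < z.re) (x : ℝ) :
    0 < (z - wedge θ ε x).re := by
  rw [Complex.sub_re, sub_pos]
  exact (wedge_re_le h₀ h₁ ε x).trans_lt hz

theorem sub_wedge_ne_zero (h₀ : 0 < θ) (h₁ : θ ≤ Real.pi / 2) (hz : ε < z.re) (x : ℝ) :
    z - wedge θ ε x ≠ 0 := fun h =>
  (sub_wedge_re_pos h₀ h₁ hz x).ne' (by rw [h, Complex.zero_re])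

namespace HasDecay

theorem integrable_inv_sub_re_mul_norm (hL : HasDecay L θ α C) (hε : 0 < ε) (hz : ε < z.re) :
    Integrable fun x => (z - wedge θ ε x).re⁻¹ * ‖L (wedge θ ε x)‖ := by
  have h₀ := hL.angle_pos
  have h₁ := hL.angle_le
  have hC := hL.const_nonneg
  have hw := isContour_wedge h₀ h₁ hε
  obtain ⟨k, hk, hre⟩ := exists_mul_one_add_abs_le (sub_pos.2 hz) (sin_half_pos h₀ h₁)
  obtain ⟨l, hl, hnorm⟩ := exists_mul_one_add_abs_le_norm_wedge h₀ h₁ hε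
  have hdom := (integrable_one_add_norm (E := ℝ) (μ := volume) (r := 1 + α)
    (by simpa using hL.exponent_pos)).const_mul (k⁻¹ * (C * l ^ (-α)))
  refine hdom.mono' ?_ (ae_of_all _ fun x => ?_)
  · exact (Continuous.mul (Continuous.inv₀ (Complex.continuous_re.comp (continuous_const.sub
      hw.continuous)) fun x => (sub_wedge_re_pos h₀ h₁ hz x).ne')
      (hL.continuous_comp hw).norm).aestronglyMeasurable
  have habs : 0 < 1 + |x| := by positivity
  have hinv : (z - wedge θ ε x).re⁻¹ ≤ k⁻¹ * (1 + |x|)⁻¹ := by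
    rw [← mul_inv, sub_wedge_re]
    exact inv_anti₀ (by positivity) (hre x)
  have hLx : ‖L (wedge θ ε x)‖ ≤ C * l ^ (-α) * (1 + |x|) ^ (-α) := by
    rw [mul_assoc, ← Real.mul_rpow hl.le habs.le]
    exact hL.bound_of_le_norm (by positivity) (hw.mem_sector x) (hnorm x)
  rw [norm_mul, norm_norm, norm_inv, Real.norm_of_nonneg (sub_wedge_re_pos h₀ h₁ hz x).le,
    Real.norm_eq_abs, neg_add, Real.rpow_add habs, Real.rpow_neg_one]
  calc _ ≤ (k⁻¹ * (1 + |x|)⁻¹) * (C * l ^ (-α) * (1 + |x|) ^ (-α)) :=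
        mul_le_mul hinv hLx (norm_nonneg _) (by positivity)
    _ = _ := by ring

theorem integrable_cauchy (hL : HasDecay L θ α C) (hε : 0 < ε) (hz : ε < z.re) :
    Integrable fun x => ((z - wedge θ ε x)⁻¹ * deriv (wedge θ ε) x) • L (wedge θ ε x) := by
  have hw := isContour_wedge hL.angle_pos hL.angle_le hε
  refine (hL.integrable_inv_sub_re_mul_norm hε hz).mono' ?_ ?_
  · have hinv : Measurable fun x => (z - wedge θ ε x)⁻¹ :=
      (measurable_const.sub hw.continuous.measurable).inv
    exact (hinv.aestronglyMeasurable.mul (measurable_deriv _).aestronglyMeasurable).smul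
      (hL.continuous_comp hw).aestronglyMeasurable
  · filter_upwards [ae_norm_deriv_wedge θ ε] with x hx
    rw [norm_smul, norm_mul, hx, mul_one, norm_inv]
    gcongr
    · exact sub_wedge_re_pos hL.angle_pos hL.angle_le hz x
    · exact Complex.re_le_norm _

end HasDecay

/-- What remains of `L ζ / (ζ - z)` when its residue at `z` is split off as the term
`(1 / (ζ - z) - 1 / ζ) L z`, which has the same decay at infinity. It is written as a difference
quotient in order to be defined at `ζ = z` too. -/
def cauchyRemainder (L : ℂ → E) (z : ℂ) : ℂ → E :=
  dslope (fun ζ => L ζ - (z / ζ) • L z) z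

theorem cauchyRemainder_of_ne (L : ℂ → E) {ζ : ℂ} (hz : z ≠ 0) (hζ : ζ ≠ z) :
    cauchyRemainder L z ζ = (ζ - z)⁻¹ • (L ζ - (z / ζ) • L z) := by
  rw [cauchyRemainder, dslope_of_ne _ hζ, slope_def_module, div_self hz, one_smul, sub_self,
    sub_zero]

theorem inv_sub_smul_eq_sub_cauchyRemainder (L : ℂ → E) {ζ : ℂ} (hz : z ≠ 0) (hζ₀ : ζ ≠ 0)
    (hζ : z - ζ ≠ 0) :
    (z - ζ)⁻¹ • L ζ = (ζ⁻¹ + (z - ζ)⁻¹) • L z - cauchyRemainder L z ζ := by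
  have hpartial : (z - ζ)⁻¹ * (z / ζ) = ζ⁻¹ + (z - ζ)⁻¹ := by field_simp; ring
  rw [cauchyRemainder_of_ne L hz (sub_ne_zero.1 hζ).symm, ← neg_sub z ζ, inv_neg, ← hpartial]
  module

theorem HasDecay.differentiableOn_cauchyRemainder [CompleteSpace E] (hL : HasDecay L θ α C)
    (hz : z ∈ sector θ) : DifferentiableOn ℂ (cauchyRemainder L z) (sector θ) := by
  refine (Complex.differentiableOn_dslope
    ((isOpen_sector hL.angle_pos hL.angle_le).mem_nhds hz)).2 (hL.differentiableOn.sub ?_)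
  exact (DifferentiableOn.div (differentiableOn_const z) differentiableOn_id
    fun ζ hζ => hζ.1).smul_const _

theorem HasDecay.norm_cauchyRemainder_le (hL : HasDecay L θ α C) (hz : z ≠ 0) {ζ : ℂ}
    (hζ : ζ ∈ sector θ) (hζz : 2 * ‖z‖ ≤ ‖ζ‖) :
    ‖cauchyRemainder L z ζ‖ ≤ (‖ζ‖ / 2)⁻¹ * (C * ‖ζ‖ ^ (-α) + ‖z‖ * ‖L z‖ / ‖ζ‖) := by
  have hζ₀ : 0 < ‖ζ‖ := norm_pos_iff.2 hζ.1
  have hne : ζ ≠ z := by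
    rintro rfl
    linarith
  have hdist : ‖ζ‖ / 2 ≤ ‖ζ - z‖ := by linarith [norm_sub_norm_le ζ z]
  have hsub : ‖L ζ - (z / ζ) • L z‖ ≤ C * ‖ζ‖ ^ (-α) + ‖z‖ * ‖L z‖ / ‖ζ‖ := by
    refine (norm_sub_le _ _).trans (add_le_add (hL.bound ζ hζ) (le_of_eq ?_))
    rw [norm_smul, norm_div, div_mul_eq_mul_div]
  rw [cauchyRemainder_of_ne L hz hne, norm_smul, norm_inv]
  gcongr

theorem HasDecay.tendsto_primitive_cauchyRemainder (hL : HasDecay L θ α C) (hε : 0 < ε)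
    (hz : z ≠ 0) {G : ℂ → E} (hG : ∀ ζ ∈ sector θ, HasDerivAt G (cauchyRemainder L z ζ) ζ) :
    Tendsto (fun y => G (wedge θ ε y) - G (wedge θ ε (-y))) atTop (𝓝 0) := by
  have hw := isContour_wedge hL.angle_pos hL.angle_le hε
  have hlim : Tendsto (fun r : ℝ => 2 * (C * r ^ (-α) + ‖z‖ * ‖L z‖ / r) * (2 * Real.pi))
      atTop (𝓝 0) := by
    have hpow := (tendsto_rpow_neg_atTop hL.exponent_pos).const_mul C
    have hinv : Tendsto (fun r : ℝ => ‖z‖ * ‖L z‖ / r) atTop (𝓝 0) := tendsto_id.const_div_atTop _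
    simpa using ((hpow.add hinv).const_mul 2).mul_const (2 * Real.pi)
  refine squeeze_zero_norm' ?_ (hlim.comp hw.upper_end)
  filter_upwards [hw.upper_end.eventually_ge_atTop (2 * ‖z‖)] with y hy
  have hpos : 0 < ‖wedge θ ε y‖ := norm_pos_iff.2 (hw.mem_sector y).1
  rw [wedge_neg]
  refine (norm_sub_conj_le_of_arc hL.angle_le hG (hw.mem_sector y) fun ζ hζ hζr =>
    hζr ▸ hL.norm_cauchyRemainder_le hz hζ (hζr ▸ hy)).trans (le_of_eq ?_)
  simp only [Function.comp]
  field_simp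

theorem hasDerivAt_log_sub_log {ζ : ℂ} (hζ : ζ ∈ Complex.slitPlane) (hre : ζ.re < z.re) :
    HasDerivAt (fun ζ => Complex.log ζ - Complex.log (z - ζ)) (ζ⁻¹ + (z - ζ)⁻¹) ζ := by
  have hsub : HasDerivAt (fun ζ => Complex.log (z - ζ)) (-1 / (z - ζ)) ζ :=
    ((hasDerivAt_id ζ).const_sub z).clog (Or.inl (by simpa using hre))
  have h := (Complex.hasDerivAt_log hζ).sub hsub
  rw [neg_div, sub_neg_eq_add, one_div] at h
  exact h

theorem HasDecay.intervalIntegral_cauchy [CompleteSpace E] (hL : HasDecay L θ α C) (hε : 0 < ε)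
    (hz : ε < z.re) {G : ℂ → E} (hG : ∀ ζ ∈ sector θ, HasDerivAt G (cauchyRemainder L z ζ) ζ)
    (a b : ℝ) :
    ∫ x in a..b, ((z - wedge θ ε x)⁻¹ * deriv (wedge θ ε) x) • L (wedge θ ε x) =
      ((Complex.log (wedge θ ε b) - Complex.log (z - wedge θ ε b)) -
        (Complex.log (wedge θ ε a) - Complex.log (z - wedge θ ε a))) • L z -
      (G (wedge θ ε b) - G (wedge θ ε a)) := by
  have h₀ := hL.angle_pos
  have h₁ := hL.angle_le
  have hw := isContour_wedge h₀ h₁ hε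
  have hzs : z ∈ sector θ := mem_sector_of_re_pos h₀ (hε.trans hz)
  have hlog : ∀ ζ ∈ range (wedge θ ε),
      HasDerivAt (fun ζ => Complex.log ζ - Complex.log (z - ζ)) (ζ⁻¹ + (z - ζ)⁻¹) ζ := by
    rintro _ ⟨x, rfl⟩
    exact hasDerivAt_log_sub_log (sector_subset_slitPlane h₁ (hw.mem_sector x))
      ((wedge_re_le h₀ h₁ ε x).trans_lt hz)
  have hlog_cont : ContinuousOn (fun ζ : ℂ => ζ⁻¹ + (z - ζ)⁻¹) (range (wedge θ ε)) := by
    refine (continuousOn_id.inv₀ ?_).add ((continuousOn_const.sub continuousOn_id).inv₀ ?_)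
    · rintro _ ⟨x, rfl⟩
      exact (hw.mem_sector x).1
    · rintro _ ⟨x, rfl⟩
      exact sub_wedge_ne_zero h₀ h₁ hz x
  have hrem := (hL.differentiableOn_cauchyRemainder hzs).continuousOn
  rw [← hw.integral_eq_sub hw.mem_sector hG hrem,
    ← hw.integral_eq_sub mem_range_self hlog hlog_cont,
    ← intervalIntegral.integral_smul_const, ← intervalIntegral.integral_sub]
  · refine intervalIntegral.integral_congr fun x _ => ?_
    rw [mul_comm, mul_smul, inv_sub_smul_eq_sub_cauchyRemainder L hzs.1 (hw.mem_sector x).1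
      (sub_wedge_ne_zero h₀ h₁ hz x), smul_sub, smul_eq_mul, mul_smul]
  · exact ((hw.intervalIntegrable_deriv _ _).smul_continuousOn (hlog_cont.comp_continuous
      hw.continuous mem_range_self).continuousOn).smul_continuousOn continuousOn_const
  · exact (hw.intervalIntegrable_deriv _ _).smul_continuousOn
      (hrem.comp_continuous hw.continuous hw.mem_sector).continuousOn

theorem HasDecay.integral_cauchy [CompleteSpace E] (hL : HasDecay L θ α C) (hε : 0 < ε)
    (hz : ε < z.re) :
    ∫ x, ((z - wedge θ ε x)⁻¹ * deriv (wedge θ ε) x) • L (wedge θ ε x) =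
      (2 * Real.pi * Complex.I) • L z := by
  have hzs : z ∈ sector θ := mem_sector_of_re_pos hL.angle_pos (hε.trans hz)
  obtain ⟨G, hG⟩ := exists_primitive_sector hL.angle_le (hL.differentiableOn_cauchyRemainder hzs)
  refine tendsto_nhds_unique (intervalIntegral_tendsto_integral (hL.integrable_cauchy hε hz)
    tendsto_neg_atTop_atBot tendsto_id) ?_
  have hlim := ((tendsto_log_wedge hL.angle_pos hL.angle_le z ε).smul_const (L z)).sub
    (hL.tendsto_primitive_cauchyRemainder hε hzs.1 hG)
  rw [sub_zero] at hlim
  exact hlim.congr fun y => (hL.intervalIntegral_cauchy hε hz hG (-y) y).symm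

theorem integral_exp_neg_mul_Ioi {b : ℝ} (hb : 0 < b) :
    ∫ t in Ioi (0 : ℝ), Real.exp (-b * t) = b⁻¹ := by
  rw [integral_exp_mul_Ioi (neg_lt_zero.2 hb) 0]
  simp [neg_div_neg_eq]

theorem integral_cexp_neg_mul_Ioi (hz : 0 < z.re) :
    ∫ t in Ioi (0 : ℝ), Complex.exp (-z * (t : ℂ)) = z⁻¹ := by
  rw [integral_exp_mul_complex_Ioi (by simpa using hz) 0]
  simp [neg_div_neg_eq]

theorem integrableOn_cexp_neg_mul_Ioi (hz : 0 < z.re) :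
    IntegrableOn (fun t : ℝ => Complex.exp (-z * (t : ℂ))) (Ioi 0) :=
  integrableOn_exp_mul_complex_Ioi (by simpa using hz) 0

theorem cexp_smul_laplaceIntegrand (L : ℂ → E) (γ : ℝ → ℂ) (z : ℂ) (t x : ℝ) :
    Complex.exp (-z * (t : ℂ)) • laplaceIntegrand L γ t x =
      Complex.exp (-(z - γ x) * (t : ℂ)) • (deriv γ x • L (γ x)) := by
  rw [laplaceIntegrand, smul_smul, smul_smul, ← mul_assoc, ← Complex.exp_add]
  ring_nf

theorem HasDecay.integrable_prod_cexp_smul (hL : HasDecay L θ α C) (hε : 0 < ε) (hz : ε < z.re) :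
    Integrable (Function.uncurry fun t x : ℝ =>
        Complex.exp (-(z - wedge θ ε x) * (t : ℂ)) • (deriv (wedge θ ε) x • L (wedge θ ε x)))
      ((volume.restrict (Ioi 0)).prod volume) := by
  have hw := isContour_wedge hL.angle_pos hL.angle_le hε
  have hpos := sub_wedge_re_pos hL.angle_pos hL.angle_le hz
  have hexp : Continuous fun q : ℝ × ℝ => Complex.exp (-(z - wedge θ ε q.2) * (q.1 : ℂ)) := by
    have := hw.continuous
    fun_prop
  have hmeas : AEStronglyMeasurable (fun x => deriv (wedge θ ε) x • L (wedge θ ε x)) volume :=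
    (measurable_deriv _).aestronglyMeasurable.smul (hL.continuous_comp hw).aestronglyMeasurable
  have hprod : AEStronglyMeasurable (Function.uncurry fun t x : ℝ =>
      Complex.exp (-(z - wedge θ ε x) * (t : ℂ)) • (deriv (wedge θ ε) x • L (wedge θ ε x)))
      ((volume.restrict (Ioi 0)).prod volume) :=
    hexp.aestronglyMeasurable.smul hmeas.comp_snd
  rw [integrable_prod_iff' hprod]
  refine ⟨ae_of_all _ fun x => (integrableOn_cexp_neg_mul_Ioi (hpos x)).smul_const
    (deriv (wedge θ ε) x • L (wedge θ ε x)), ?_⟩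
  refine (hL.integrable_inv_sub_re_mul_norm hε hz).congr ?_
  filter_upwards [ae_norm_deriv_wedge θ ε] with x hx
  simp only [Function.uncurry, norm_smul, norm_exp_mul_ofReal, hx, one_mul]
  rw [integral_mul_const, ← integral_exp_neg_mul_Ioi (hpos x)]
  simp only [Complex.neg_re, mul_comm]

theorem HasDecay.laplace_invLaplace [CompleteSpace E] (hL : HasDecay L θ α C)
    (hγ : IsContour θ γ) (hz : 0 < z.re) :
    ∫ t in Ioi (0 : ℝ), Complex.exp (-z * (t : ℂ)) • invLaplace L γ t = L z := by
  obtain ⟨ε, hε, hεz⟩ := exists_between hz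
  have hwedge : ∫ t in Ioi (0 : ℝ), Complex.exp (-z * (t : ℂ)) • invLaplace L γ t =
      (1 / (2 * (Real.pi : ℂ) * Complex.I)) • ∫ t in Ioi (0 : ℝ), ∫ x,
        Complex.exp (-(z - wedge θ ε x) * (t : ℂ)) •
          (deriv (wedge θ ε) x • L (wedge θ ε x)) := by
    rw [← integral_smul]
    refine setIntegral_congr_fun measurableSet_Ioi fun t ht => ?_
    simp only [← cexp_smul_laplaceIntegrand]
    rw [hL.invLaplace_eq_wedge hγ ht hε, invLaplace, smul_comm, integral_smul]
  have hinner : ∀ x, ∫ t in Ioi (0 : ℝ), Complex.exp (-(z - wedge θ ε x) * (t : ℂ)) •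
      (deriv (wedge θ ε) x • L (wedge θ ε x)) =
      ((z - wedge θ ε x)⁻¹ * deriv (wedge θ ε) x) • L (wedge θ ε x) := fun x => by
    rw [integral_smul_const, smul_smul,
      integral_cexp_neg_mul_Ioi (sub_wedge_re_pos hL.angle_pos hL.angle_le hεz x)]
  rw [hwedge, integral_integral_swap (hL.integrable_prod_cexp_smul hε hεz)]
  simp only [hinner]
  rw [hL.integral_cauchy hε hεz, smul_smul, one_div, inv_mul_cancel₀ Complex.two_pi_I_ne_zero,
    one_smul]

end LaplaceTransform

/-! ### Uniqueness and calculus of Laplace transforms -/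

section Kernel

variable {E : Type*} [NormedAddCommGroup E] {f : ℝ → E} {c K : ℝ}

/-- `f` is continuous on `(0, ∞)` and dominated there by `K t ^ (c - 1)`. -/
structure IsKernel (f : ℝ → E) (c K : ℝ) : Prop where
  exponent_pos : 0 < c
  continuousOn : ContinuousOn f (Ioi 0)
  bound : ∀ t > 0, ‖f t‖ ≤ K * t ^ (c - 1)

namespace IsKernel

theorem const_nonneg (hf : IsKernel f c K) : 0 ≤ K := by
  simpa using (norm_nonneg _).trans (hf.bound 1 one_pos)

theorem comp_projIcc {t : ℝ} (ht : 0 ≤ t) (hf : ContinuousOn f (Icc 0 t)) :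
    ∃ M, IsKernel (fun s => f (projIcc 0 t ht s)) 1 M := by
  obtain ⟨M, hM⟩ := isCompact_Icc.exists_bound_of_continuousOn hf
  refine ⟨M, one_pos, ?_, fun s _ => ?_⟩
  · exact (hf.comp_continuous (continuous_subtype_val.comp continuous_projIcc)
      fun s => (projIcc 0 t ht s).2).continuousOn
  · simpa using hM _ (projIcc 0 t ht s).2

end IsKernel

end Kernel

section Laplace

variable {E F : Type*} [NormedAddCommGroup E] [NormedSpace ℂ E]
  [NormedAddCommGroup F] [NormedSpace ℂ F]

/-- The Laplace transform `∫₀^∞ e^{-z t} f(t) dt`. -/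
def laplace (f : ℝ → E) (z : ℂ) : E :=
  ∫ t in Ioi (0 : ℝ), Complex.exp (-z * (t : ℂ)) • f t

/-- `G` is the Laplace transform of `f` on the half-plane `Re z > 0`, where the defining integral
converges absolutely. -/
structure HasLaplace (f : ℝ → E) (G : ℂ → E) : Prop where
  integrableOn : ∀ z : ℂ, 0 < z.re →
    IntegrableOn (fun t : ℝ => Complex.exp (-z * (t : ℂ)) • f t) (Ioi 0)
  laplace_eq : ∀ z : ℂ, 0 < z.re → laplace f z = G z

variable {f g : ℝ → E} {G H : ℂ → E} {c K : ℝ}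

namespace HasLaplace

theorem congr_right (hf : HasLaplace f G) (h : ∀ z : ℂ, 0 < z.re → G z = H z) : HasLaplace f H :=
  ⟨hf.integrableOn, fun z hz => (hf.laplace_eq z hz).trans (h z hz)⟩

theorem add (hf : HasLaplace f G) (hg : HasLaplace g H) :
    HasLaplace (fun t => f t + g t) fun z => G z + H z where
  integrableOn z hz := by
    simp only [smul_add]
    exact (hf.integrableOn z hz).add (hg.integrableOn z hz)
  laplace_eq z hz := by
    rw [← hf.laplace_eq z hz, ← hg.laplace_eq z hz]
    simp only [laplace, smul_add]
    exact integral_add (hf.integrableOn z hz) (hg.integrableOn z hz)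

theorem sub (hf : HasLaplace f G) (hg : HasLaplace g H) :
    HasLaplace (fun t => f t - g t) fun z => G z - H z where
  integrableOn z hz := by
    simp only [smul_sub]
    exact (hf.integrableOn z hz).sub (hg.integrableOn z hz)
  laplace_eq z hz := by
    rw [← hf.laplace_eq z hz, ← hg.laplace_eq z hz]
    simp only [laplace, smul_sub]
    exact integral_sub (hf.integrableOn z hz) (hg.integrableOn z hz)

theorem clm_comp [CompleteSpace E] [CompleteSpace F] (R : E →L[ℂ] F) (hf : HasLaplace f G) :
    HasLaplace (fun t => R (f t)) fun z => R (G z) where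
  integrableOn z hz := by
    simpa only [map_smul, IntegrableOn] using R.integrable_comp (hf.integrableOn z hz)
  laplace_eq z hz := by
    rw [← hf.laplace_eq z hz, laplace, laplace, ← R.integral_comp_comm (hf.integrableOn z hz)]
    simp only [map_smul]

theorem intervalIntegrable (hf : HasLaplace f G) {t : ℝ} (ht : 0 ≤ t) :
    IntervalIntegrable f volume 0 t := by
  have h := (hf.integrableOn 1 (by simp)).mono_set (Ioc_subset_Ioi_self (a := t) (b := 0))
  rw [← intervalIntegrable_iff_integrableOn_Ioc_of_le ht] at h
  have hexp : ContinuousOn (fun s : ℝ => Complex.exp (s : ℂ)) (uIcc 0 t) := by fun_prop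
  refine (h.continuousOn_smul hexp).congr fun s _ => ?_
  simp only [smul_smul, ← Complex.exp_add]
  simp

open FourierTransform in
theorem fourier_indicator_eq_zero (hf : HasLaplace f 0) :
    𝓕 (indicator (Ioi 0) fun t : ℝ => Complex.exp (-1 * (t : ℂ)) • f t) = 0 := by
  ext ξ
  rw [Real.fourier_real_eq_integral_exp_smul]
  have hshift : (fun v : ℝ => Complex.exp (((-2 * Real.pi * v * ξ : ℝ) : ℂ) * Complex.I) •
      indicator (Ioi 0) (fun t : ℝ => Complex.exp (-1 * (t : ℂ)) • f t) v) =
      indicator (Ioi (0 : ℝ)) fun v : ℝ =>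
        Complex.exp (-(1 + 2 * Real.pi * ξ * Complex.I) * (v : ℂ)) • f v := by
    ext v
    rw [← indicator_const_smul_apply, indicator_apply, indicator_apply, smul_smul,
      ← Complex.exp_add]
    congr 3
    push_cast
    ring
  rw [hshift, integral_indicator measurableSet_Ioi]
  exact hf.laplace_eq _ (by simp)

theorem eqOn_zero [CompleteSpace E] (hf : HasLaplace f 0) (hc : ContinuousOn f (Ioi 0)) :
    EqOn f 0 (Ioi 0) := fun t ht => by
  have hint := (integrable_indicator_iff measurableSet_Ioi).2 (hf.integrableOn 1 (by simp))
  have hcont : ContinuousAt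
      (indicator (Ioi 0) fun t : ℝ => Complex.exp (-1 * (t : ℂ)) • f t) t := by
    have h : ContinuousAt (fun t : ℝ => Complex.exp (-1 * (t : ℂ)) • f t) t :=
      ContinuousAt.smul (by fun_prop) (hc.continuousAt (Ioi_mem_nhds ht))
    exact h.congr ((eqOn_indicator.eventuallyEq_of_mem (Ioi_mem_nhds ht)).symm)
  have hinv := hint.fourierInv_fourier_eq
    (by rw [hf.fourier_indicator_eq_zero]; exact integrable_zero _ _ _) hcont
  rw [hf.fourier_indicator_eq_zero, Real.fourierInv_eq, indicator_of_mem ht] at hinv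
  simp only [Pi.zero_apply, smul_zero, integral_zero] at hinv
  exact (smul_eq_zero.1 hinv.symm).resolve_left (Complex.exp_ne_zero _)

theorem eqOn [CompleteSpace E] (hf : HasLaplace f G) (hg : HasLaplace g G)
    (hfc : ContinuousOn f (Ioi 0)) (hgc : ContinuousOn g (Ioi 0)) : EqOn f g (Ioi 0) :=
  fun _ ht => sub_eq_zero.1 (((hf.sub hg).congr_right fun _ _ => sub_self _).eqOn_zero
    (hfc.sub hgc) ht)

end HasLaplace

namespace IsKernel

theorem integrableOn_cexp_smul (hf : IsKernel f c K) {z : ℂ} (hz : 0 < z.re) :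
    IntegrableOn (fun t : ℝ => Complex.exp (-z * (t : ℂ)) • f t) (Ioi 0) := by
  have hdom : IntegrableOn (fun t : ℝ => t ^ (c - 1) * Real.exp (-(z.re * t))) (Ioi 0) := by
    simpa using integrableOn_rpow_mul_exp_neg_mul_rpow (p := 1) (s := c - 1)
      (by linarith [hf.exponent_pos]) one_pos hz
  refine (hdom.const_mul K).mono' ?_ ((ae_restrict_iff' measurableSet_Ioi).2 (ae_of_all _ ?_))
  · refine ContinuousOn.aestronglyMeasurable (ContinuousOn.smul ?_ hf.continuousOn)
      measurableSet_Ioi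
    fun_prop
  · intro t ht
    rw [norm_smul, norm_exp_mul_ofReal, mul_comm, ← mul_assoc, Complex.neg_re, mul_neg, mul_comm t]
    exact mul_le_mul_of_nonneg_right (hf.bound t ht) (Real.exp_pos _).le

theorem hasLaplace (hf : IsKernel f c K) : HasLaplace f (laplace f) :=
  ⟨fun _ hz => hf.integrableOn_cexp_smul hz, fun _ _ => rfl⟩

theorem clm_comp (R : E →L[ℂ] F) (hf : IsKernel f c K) :
    IsKernel (fun t => R (f t)) c (‖R‖ * K) where
  exponent_pos := hf.exponent_pos
  continuousOn := R.continuous.comp_continuousOn hf.continuousOn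
  bound t ht := by
    rw [mul_assoc]
    exact R.le_opNorm_of_le (hf.bound t ht)

theorem clm_apply {a : ℝ → E →L[ℂ] F} (ha : IsKernel a c K) (x : E) :
    IsKernel (fun t => a t x) c (‖ContinuousLinearMap.apply ℂ F x‖ * K) :=
  ha.clm_comp (ContinuousLinearMap.apply ℂ F x)

end IsKernel

theorem HasDecay.isKernel_invLaplace [CompleteSpace E] {L : ℂ → E} {θ α C : ℝ} {γ : ℝ → ℂ}
    (hL : HasDecay L θ α C) (hγ : IsContour θ γ) : ∃ M, IsKernel (invLaplace L γ) α M := by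
  obtain ⟨M, hM⟩ := hL.exists_norm_invLaplace_le hγ
  exact ⟨M, hL.exponent_pos,
    fun t ht => (hL.continuousAt_invLaplace hγ ht).continuousWithinAt, hM⟩

theorem HasDecay.hasLaplace_invLaplace [CompleteSpace E] {L : ℂ → E} {θ α C : ℝ} {γ : ℝ → ℂ}
    (hL : HasDecay L θ α C) (hγ : IsContour θ γ) : HasLaplace (invLaplace L γ) L := by
  obtain ⟨M, hM⟩ := hL.isKernel_invLaplace hγ
  exact ⟨hM.hasLaplace.integrableOn, fun z hz => hL.laplace_invLaplace hγ hz⟩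

end Laplace

/-! ### The power kernels -/

section PowerKernel

variable {β t : ℝ}

theorem Phi_of_pos (ht : 0 < t) : Phi β t = t ^ (β - 1) / Real.Gamma β := if_pos ht

theorem Phi_one_of_pos (ht : 0 < t) : Phi 1 t = 1 := by
  rw [Phi_of_pos ht, sub_self, Real.rpow_zero, Real.Gamma_one, div_one]

theorem Phi_nonneg (hβ : 0 < β) (t : ℝ) : 0 ≤ Phi β t := by
  have := Real.Gamma_pos_of_pos hβ
  unfold Phi
  split_ifs <;> positivity

theorem isKernel_Phi (hβ : 0 < β) :
    IsKernel (fun t => ((Phi β t : ℝ) : ℂ)) β (Real.Gamma β)⁻¹ where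
  exponent_pos := hβ
  continuousOn := by
    have h : ContinuousOn (fun t : ℝ => t ^ (β - 1) / Real.Gamma β) (Ioi 0) :=
      (continuousOn_id.rpow_const fun t ht => Or.inl (ne_of_gt ht)).div_const _
    exact Complex.continuous_ofReal.comp_continuousOn (h.congr fun t ht => Phi_of_pos ht)
  bound t ht := by
    rw [Complex.norm_of_nonneg (Phi_nonneg hβ t), Phi_of_pos ht, div_eq_inv_mul]

theorem IsKernel.differentiableAt_laplace {E : Type*} [NormedAddCommGroup E] [NormedSpace ℂ E]
    {f : ℝ → E} {c K : ℝ} (hf : IsKernel f c K) {z : ℂ} (hz : 0 < z.re) :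
    DifferentiableAt ℂ (laplace f) z := by
  have hre : ∀ ζ ∈ Metric.ball z (z.re / 2), z.re / 2 ≤ ζ.re := fun ζ hζ => by
    have h := (Complex.abs_re_le_norm (ζ - z)).trans (mem_ball_iff_norm.1 hζ).le
    rw [Complex.sub_re] at h
    linarith [(abs_le.1 h).1]
  have hmeas : ∀ ζ : ℂ, AEStronglyMeasurable (fun t : ℝ => Complex.exp (-ζ * (t : ℂ)) • f t)
      (volume.restrict (Ioi 0)) := fun ζ =>
    ((by fun_prop : Continuous fun t : ℝ => Complex.exp (-ζ * (t : ℂ))).continuousOn.smul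
      hf.continuousOn).aestronglyMeasurable measurableSet_Ioi
  have hdom : IntegrableOn (fun t : ℝ => t ^ c * Real.exp (-(z.re / 2 * t))) (Ioi 0) := by
    simpa using integrableOn_rpow_mul_exp_neg_mul_rpow (p := 1) (s := c)
      (by linarith [hf.exponent_pos]) one_pos (half_pos hz)
  refine (hasDerivAt_integral_of_dominated_loc_of_deriv_le
    (F' := fun ζ t => -(t : ℂ) • Complex.exp (-ζ * (t : ℂ)) • f t)
    (Metric.ball_mem_nhds z (half_pos hz)) (.of_forall hmeas) (hf.integrableOn_cexp_smul hz) ?_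
    ((ae_restrict_iff' measurableSet_Ioi).2 (ae_of_all _ fun t ht ζ hζ => ?_))
    (hdom.const_mul K) (ae_of_all _ fun t ζ _ => ?_)).2.differentiableAt
  · exact (by fun_prop : Continuous fun t : ℝ => -(t : ℂ)).aestronglyMeasurable.smul (hmeas z)
  · have ht' : 0 < t := ht
    rw [norm_smul, norm_smul, norm_exp_mul_ofReal, norm_neg, Complex.norm_of_nonneg ht'.le]
    calc t * (Real.exp (t * (-ζ).re) * ‖f t‖)
        ≤ t * (Real.exp (-(z.re / 2 * t)) * (K * t ^ (c - 1))) := by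
          gcongr
          · rw [Complex.neg_re]
            nlinarith [hre ζ hζ]
          · exact hf.bound t ht
      _ = K * (t ^ c * Real.exp (-(z.re / 2 * t))) := by
          rw [Real.rpow_sub_one ht'.ne']
          field_simp
  · rw [smul_smul, mul_comm (-(t : ℂ))]
    exact ((((hasDerivAt_id ζ).neg.mul_const (t : ℂ)).cexp).smul_const (f t)).congr_deriv
      (by simp)

theorem laplace_Phi_ofReal (hβ : 0 < β) {r : ℝ} (hr : 0 < r) :
    laplace (fun t => ((Phi β t : ℝ) : ℂ)) r = (r : ℂ) ^ (-(β : ℂ)) := by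
  have hΓ := (Real.Gamma_pos_of_pos hβ).ne'
  have h : laplace (fun t => ((Phi β t : ℝ) : ℂ)) r =
      ∫ t in Ioi (0 : ℝ), (((Real.Gamma β)⁻¹ * (t ^ (β - 1) * Real.exp (-(r * t))) : ℝ) : ℂ) := by
    refine setIntegral_congr_fun measurableSet_Ioi fun t ht => ?_
    simp only [Phi_of_pos ht, smul_eq_mul]
    push_cast
    ring_nf
  rw [h, integral_complex_ofReal, integral_const_mul,
    Real.integral_rpow_mul_exp_neg_mul_Ioi hβ hr, mul_left_comm, inv_mul_cancel₀ hΓ, mul_one,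
    one_div, Real.inv_rpow hr.le, ← Real.rpow_neg hr.le, Complex.ofReal_cpow hr.le,
    Complex.ofReal_neg]

theorem hasLaplace_Phi (hβ : 0 < β) :
    HasLaplace (fun t => ((Phi β t : ℝ) : ℂ)) fun z => z ^ (-(β : ℂ)) := by
  have hΦ := isKernel_Phi hβ
  refine ⟨hΦ.hasLaplace.integrableOn, fun z hz => ?_⟩
  -- Both sides are holomorphic on the right half-plane and agree on the positive real axis.
  have hopen : IsOpen {z : ℂ | 0 < z.re} := isOpen_lt continuous_const Complex.continuous_re
  have hleft : AnalyticOnNhd ℂ (laplace fun t => ((Phi β t : ℝ) : ℂ)) {z | 0 < z.re} :=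
    DifferentiableOn.analyticOnNhd
      (fun z hz => (hΦ.differentiableAt_laplace hz).differentiableWithinAt) hopen
  have hright : AnalyticOnNhd ℂ (fun z : ℂ => z ^ (-(β : ℂ))) {z | 0 < z.re} :=
    DifferentiableOn.analyticOnNhd (fun z hz =>
      (differentiableAt_id.cpow_const (Or.inl hz)).differentiableWithinAt) hopen
  have hreal : Tendsto (fun r : ℝ => (r : ℂ)) (𝓝[≠] 1) (𝓝[≠] 1) :=
    Complex.continuous_ofReal.continuousWithinAt.tendsto_nhdsWithin fun r hr => by
      simpa using hr
  have hfreq : ∃ᶠ z in 𝓝[≠] (1 : ℂ), laplace (fun t => ((Phi β t : ℝ) : ℂ)) z =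
      z ^ (-(β : ℂ)) := by
    refine hreal.frequently (Eventually.frequently ?_)
    filter_upwards [mem_nhdsWithin_of_mem_nhds (lt_mem_nhds one_pos)] with r hr
    exact laplace_Phi_ofReal hβ hr
  exact hleft.eqOn_of_preconnected_of_frequently_eq hright
    (convex_halfSpace_re_gt 0).isPreconnected (by simp) hfreq hz

end PowerKernel

/-! ### Convolution with operator kernels -/

theorem integrableOn_beta {c d : ℝ} (hc : 0 < c) (hd : 0 < d) :
    IntegrableOn (fun x : ℝ => (1 - x) ^ (c - 1) * x ^ (d - 1)) (Ioo 0 1) := by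
  have h := (Complex.betaIntegral_convergent (u := d) (v := c) (by simpa) (by simpa)).norm
  rw [intervalIntegrable_iff_integrableOn_Ioo_of_le zero_le_one] at h
  refine h.congr_fun (fun x hx => ?_) measurableSet_Ioo
  have hsub : (1 : ℂ) - (x : ℂ) = ((1 - x : ℝ) : ℂ) := by push_cast; rfl
  simp only [norm_mul]
  rw [hsub, Complex.norm_cpow_eq_rpow_re_of_pos hx.1,
    Complex.norm_cpow_eq_rpow_re_of_pos (sub_pos.2 hx.2)]
  simp [mul_comm]

section OpConv

variable {X Y : Type*} [NormedAddCommGroup X] [NormedSpace ℂ X]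
  [NormedAddCommGroup Y] [NormedSpace ℂ Y]

/-- The convolution `∫₀ᵗ a(t - s) h(s) ds` of an operator-valued kernel with a function. -/
def opConv (a : ℝ → X →L[ℂ] Y) (h : ℝ → X) (t : ℝ) : Y :=
  ∫ s in (0 : ℝ)..t, a (t - s) (h s)

variable {a : ℝ → X →L[ℂ] Y} {h k : ℝ → X} {c d K M t : ℝ}

theorem opConv_congr (ht : 0 ≤ t) (hhk : EqOn h k (Ioo 0 t)) : opConv a h t = opConv a k t := by
  simp only [opConv, intervalIntegral.integral_of_le ht, integral_Ioc_eq_integral_Ioo]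
  exact setIntegral_congr_fun measurableSet_Ioo fun s hs => by rw [hhk hs]

theorem opConv_const (x : X) (t : ℝ) : opConv a (fun _ => x) t = ∫ s in (0 : ℝ)..t, a s x := by
  simp [opConv, intervalIntegral.integral_comp_sub_left (fun s => a s x) t]

theorem opConv_eq_smul (a : ℝ → X →L[ℂ] Y) (h : ℝ → X) (t : ℝ) :
    opConv a h t = t • ∫ x in Ioo (0 : ℝ) 1, a (t * (1 - x)) (h (t * x)) := by
  have := intervalIntegral.smul_integral_comp_mul_left (a := 0) (b := 1)
    (fun s => a (t - s) (h s)) t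
  simpa [opConv, mul_sub, intervalIntegral.integral_of_le zero_le_one,
    integral_Ioc_eq_integral_Ioo] using this.symm

namespace IsKernel

theorem norm_clm_apply_le (ha : IsKernel a c K) (hh : IsKernel h d M) (ht : 0 < t) {x : ℝ}
    (hx : x ∈ Ioo (0 : ℝ) 1) :
    ‖a (t * (1 - x)) (h (t * x))‖ ≤
      K * M * t ^ (c + d - 2) * ((1 - x) ^ (c - 1) * x ^ (d - 1)) := by
  have hx' : 0 < 1 - x := sub_pos.2 hx.2
  have hK := ha.const_nonneg
  calc ‖a (t * (1 - x)) (h (t * x))‖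
      ≤ K * (t * (1 - x)) ^ (c - 1) * (M * (t * x) ^ (d - 1)) :=
        (a _).le_of_opNorm_le_of_le (ha.bound _ (mul_pos ht hx')) (hh.bound _ (mul_pos ht hx.1))
    _ = K * M * t ^ (c + d - 2) * ((1 - x) ^ (c - 1) * x ^ (d - 1)) := by
        rw [Real.mul_rpow ht.le hx'.le, Real.mul_rpow ht.le hx.1.le,
          show c + d - 2 = (c - 1) + (d - 1) by ring, Real.rpow_add ht]
        ring

theorem continuousOn_clm_apply (ha : IsKernel a c K) (hh : IsKernel h d M) :
    ContinuousOn (fun q : ℝ × ℝ => a (q.1 * (1 - q.2)) (h (q.1 * q.2)))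
      (Ioi 0 ×ˢ Ioo 0 1) := by
  refine (ha.continuousOn.comp (by fun_prop) fun q hq => ?_).clm_apply
    (hh.continuousOn.comp (by fun_prop) fun q hq => ?_)
  · exact mul_pos hq.1 (sub_pos.2 hq.2.2)
  · exact mul_pos hq.1 hq.2.1

theorem aestronglyMeasurable_clm_apply (ha : IsKernel a c K) (hh : IsKernel h d M) (ht : 0 < t) :
    AEStronglyMeasurable (fun x => a (t * (1 - x)) (h (t * x))) (volume.restrict (Ioo 0 1)) :=
  ((ha.continuousOn_clm_apply hh).comp (by fun_prop : ContinuousOn (fun x => (t, x)) _)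
    fun _ hx => ⟨ht, hx⟩).aestronglyMeasurable measurableSet_Ioo

theorem intervalIntegrable_clm_apply (ha : IsKernel a c K) (hh : IsKernel h d M) (ht : 0 < t) :
    IntervalIntegrable (fun s => a (t - s) (h s)) volume 0 t := by
  have hscaled : IntegrableOn (fun x => a (t * (1 - x)) (h (t * x))) (Ioo 0 1) :=
    ((integrableOn_beta ha.exponent_pos hh.exponent_pos).const_mul
      (K * M * t ^ (c + d - 2))).mono' (ha.aestronglyMeasurable_clm_apply hh ht)
      ((ae_restrict_iff' measurableSet_Ioo).2
        (ae_of_all _ fun x hx => ha.norm_clm_apply_le hh ht hx))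
  rw [← intervalIntegrable_iff_integrableOn_Ioo_of_le zero_le_one] at hscaled
  have h := hscaled.comp_mul_left (c := t⁻¹)
  simp only [zero_div, one_div, inv_inv] at h
  refine h.congr fun s _ => ?_
  simp only [mul_sub, mul_one, mul_inv_cancel_left₀ ht.ne']

theorem continuousAt_opConv (ha : IsKernel a c K) (hh : IsKernel h d M) (ht : 0 < t) :
    ContinuousAt (opConv a h) t := by
  simp only [funext (opConv_eq_smul a h)]
  refine continuousAt_id.smul ?_
  have hKM := mul_nonneg ha.const_nonneg hh.const_nonneg
  have hpow : ∀ᶠ s in 𝓝 t, s ^ (c + d - 2) ≤ t ^ (c + d - 2) + 1 :=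
    ((Real.continuousAt_rpow_const t _ (Or.inl ht.ne')).eventually_lt_const
      (lt_add_one _)).mono fun _ => le_of_lt
  refine continuousAt_of_dominated (F := fun s x => a (s * (1 - x)) (h (s * x)))
    (bound := fun x => K * M * (t ^ (c + d - 2) + 1) * ((1 - x) ^ (c - 1) * x ^ (d - 1)))
    ?_ ?_ ((integrableOn_beta ha.exponent_pos hh.exponent_pos).const_mul _) ?_
  · filter_upwards [lt_mem_nhds ht] with s hs using ha.aestronglyMeasurable_clm_apply hh hs
  · filter_upwards [lt_mem_nhds ht, hpow] with s hs hpow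
    refine (ae_restrict_iff' measurableSet_Ioo).2 (ae_of_all _ fun x hx => ?_)
    refine (ha.norm_clm_apply_le hh hs hx).trans ?_
    have hx' : 0 < 1 - x := sub_pos.2 hx.2
    have hx₀ : 0 < x := hx.1
    gcongr
  · refine (ae_restrict_iff' measurableSet_Ioo).2 (ae_of_all _ fun x hx => ?_)
    exact ContinuousAt.comp' (f := fun s => (s, x))
      ((ha.continuousOn_clm_apply hh).continuousAt
        ((isOpen_Ioi.prod isOpen_Ioo).mem_nhds ⟨ht, hx⟩)) (by fun_prop)

protected theorem opConv (ha : IsKernel a c K) (hh : IsKernel h d M) :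
    IsKernel (opConv a h) (c + d)
      (K * M * ∫ x in Ioo (0 : ℝ) 1, (1 - x) ^ (c - 1) * x ^ (d - 1)) where
  exponent_pos := add_pos ha.exponent_pos hh.exponent_pos
  continuousOn _ ht := (ha.continuousAt_opConv hh ht).continuousWithinAt
  bound t ht := by
    rw [opConv_eq_smul, norm_smul, Real.norm_of_nonneg (le_of_lt ht)]
    calc t * ‖∫ x in Ioo (0 : ℝ) 1, a (t * (1 - x)) (h (t * x))‖
        ≤ t * ∫ x in Ioo (0 : ℝ) 1, K * M * t ^ (c + d - 2) *
            ((1 - x) ^ (c - 1) * x ^ (d - 1)) := by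
          gcongr
          exact norm_integral_le_of_norm_le
            ((integrableOn_beta ha.exponent_pos hh.exponent_pos).const_mul _)
            ((ae_restrict_iff' measurableSet_Ioo).2
              (ae_of_all _ fun x hx => ha.norm_clm_apply_le hh ht hx))
      _ = _ := by
          rw [integral_const_mul, show c + d - 1 = c + d - 2 + 1 by ring,
            Real.rpow_add_one (ne_of_gt ht)]
          ring

theorem continuousWithinAt_zero {E : Type*} [NormedAddCommGroup E] {f : ℝ → E}
    (hf : IsKernel f c K) (hc : 1 < c) (h₀ : f 0 = 0) : ContinuousWithinAt f (Ici 0) 0 := by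
  rw [ContinuousWithinAt, h₀]
  refine squeeze_zero_norm' (a := fun t => K * t ^ (c - 1)) ?_ ?_
  · filter_upwards [self_mem_nhdsWithin] with t ht
    rcases (mem_Ici.1 ht).eq_or_lt with rfl | ht
    · simp [h₀, Real.zero_rpow (sub_pos.2 hc).ne']
    · exact hf.bound t ht
  · have h := (Real.continuousAt_rpow_const 0 (c - 1) (Or.inr (sub_pos.2 hc).le)).const_mul K
    simpa [Real.zero_rpow (sub_pos.2 hc).ne'] using h.tendsto.mono_left nhdsWithin_le_nhds

theorem continuousOn_Ici {E : Type*} [NormedAddCommGroup E] {f : ℝ → E}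
    (hf : IsKernel f c K) (hc : 1 < c) (h₀ : f 0 = 0) : ContinuousOn f (Ici 0) := by
  intro t ht
  rcases (mem_Ici.1 ht).eq_or_lt with rfl | ht
  · exact hf.continuousWithinAt_zero hc h₀
  · exact (hf.continuousOn.continuousAt (Ioi_mem_nhds ht)).continuousWithinAt

theorem continuousOn_opConv {T : ℝ} (ha : IsKernel a c K) (hh : ContinuousOn h (Ico 0 T)) :
    ContinuousOn (opConv a h) (Ico 0 T) := by
  intro t ht
  obtain ⟨T', htT', hT'⟩ := exists_between ht.2
  have hT'₀ : 0 ≤ T' := ht.1.trans htT'.le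
  obtain ⟨M, hM⟩ := comp_projIcc hT'₀ (hh.mono (Icc_subset_Ico_right hT'))
  have hcont := (ha.opConv hM).continuousOn_Ici (by linarith [ha.exponent_pos])
    intervalIntegral.integral_same
  have heq : EqOn (opConv a h) (opConv a fun s => h (projIcc 0 T' hT'₀ s)) (Icc 0 T') :=
    fun s hs => opConv_congr hs.1 fun r hr => by
      rw [projIcc_of_mem hT'₀ ⟨hr.1.le, hr.2.le.trans hs.2⟩]
  have hnhds : Icc 0 T' ∈ 𝓝[Ico 0 T] t := by
    filter_upwards [self_mem_nhdsWithin, mem_nhdsWithin_of_mem_nhds (Iio_mem_nhds htT')]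
      with s hs hsT' using ⟨hs.1, le_of_lt hsT'⟩
  exact ((hcont t ht.1).mono Ico_subset_Ici_self).congr_of_eventuallyEq
    (heq.eventuallyEq_of_mem hnhds) (heq ⟨ht.1, htT'.le⟩)

end IsKernel

theorem exp_smul_opConv (a : ℝ → X →L[ℂ] Y) (h : ℝ → X) (z : ℂ) (t : ℝ) :
    Complex.exp (-z * (t : ℂ)) • opConv a h t =
      ∫ s in (0 : ℝ)..t,
        (ContinuousLinearMap.apply ℂ Y : X →L[ℂ] (X →L[ℂ] Y) →L[ℂ] Y).bilinearRestrictScalars ℝ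
          (Complex.exp (-z * (s : ℂ)) • h s)
          (Complex.exp (-z * ((t - s : ℝ) : ℂ)) • a (t - s)) := by
  rw [opConv, ← intervalIntegral.integral_smul]
  refine intervalIntegral.integral_congr fun s _ => ?_
  simp only [ContinuousLinearMap.bilinearRestrictScalars_apply_apply,
    ContinuousLinearMap.apply_apply, FunLike.coe_smul, Pi.smul_apply, map_smul, smul_smul,
    ← Complex.exp_add]
  congr 2
  push_cast
  ring

theorem HasLaplace.opConv [CompleteSpace X] [CompleteSpace Y] {A : ℂ → X →L[ℂ] Y} {H : ℂ → X}
    (ha : HasLaplace a A) (hh : HasLaplace h H) :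
    HasLaplace (opConv a h) fun z => A z (H z) where
  integrableOn z hz := by
    have h := integrable_posConvolution (hh.integrableOn z hz) (ha.integrableOn z hz)
      ((ContinuousLinearMap.apply ℂ Y : X →L[ℂ] (X →L[ℂ] Y) →L[ℂ] Y).bilinearRestrictScalars ℝ)
    rw [posConvolution, integrable_indicator_iff measurableSet_Ioi] at h
    simpa only [exp_smul_opConv] using h
  laplace_eq z hz := by
    have h := integral_posConvolution (hh.integrableOn z hz) (ha.integrableOn z hz)
      ((ContinuousLinearMap.apply ℂ Y : X →L[ℂ] (X →L[ℂ] Y) →L[ℂ] Y).bilinearRestrictScalars ℝ)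
    simp only [← exp_smul_opConv] at h
    rw [← ha.laplace_eq z hz, ← hh.laplace_eq z hz]
    exact h

end OpConv

/-! ### Fractional integrals -/

theorem intervalIntegrable_congr_Ioo {E : Type*} [NormedAddCommGroup E] {h k : ℝ → E} {t : ℝ}
    (ht : 0 ≤ t) (hhk : EqOn h k (Ioo 0 t)) :
    IntervalIntegrable h volume 0 t ↔ IntervalIntegrable k volume 0 t := by
  rw [intervalIntegrable_iff_integrableOn_Ioo_of_le ht,
    intervalIntegrable_iff_integrableOn_Ioo_of_le ht]
  exact integrableOn_congr_fun hhk measurableSet_Ioo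

section PhiConv

variable {X Y : Type*} [NormedAddCommGroup X] [NormedSpace ℂ X]
  [NormedAddCommGroup Y] [NormedSpace ℂ Y]
  {a : ℝ → X →L[ℂ] Y} {f h k : ℝ → X} {F H : ℂ → X} {β c d K M t T : ℝ}

theorem opConv_add (hh : IntervalIntegrable (fun s => a (t - s) (h s)) volume 0 t)
    (hk : IntervalIntegrable (fun s => a (t - s) (k s)) volume 0 t) :
    opConv a (fun s => h s + k s) t = opConv a h t + opConv a k t := by
  simp only [opConv, map_add]
  exact intervalIntegral.integral_add hh hk

theorem IsKernel.intervalIntegrable_clm_apply_of_continuousOn (ha : IsKernel a c K)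
    (ht : 0 ≤ t) (hh : ContinuousOn h (Icc 0 t)) :
    IntervalIntegrable (fun s => a (t - s) (h s)) volume 0 t := by
  rcases ht.eq_or_lt with rfl | ht₀
  · exact IntervalIntegrable.refl
  obtain ⟨M, hM⟩ := IsKernel.comp_projIcc ht hh
  refine (intervalIntegrable_congr_Ioo ht fun s hs => ?_).2
    (ha.intervalIntegrable_clm_apply hM ht₀)
  simp only [projIcc_of_mem ht (Ioo_subset_Icc_self hs)]

/-- Multiplication by `Φ_β(t)`, the operator kernel of the fractional integral `Φ_β * ·`. -/
def phiOp (X : Type*) [NormedAddCommGroup X] [NormedSpace ℂ X] (β t : ℝ) : X →L[ℂ] X :=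
  ((Phi β t : ℝ) : ℂ) • ContinuousLinearMap.id ℂ X

theorem phiConv_eq_opConv (β : ℝ) (f : ℝ → X) : phiConv β f = opConv (phiOp X β) f := by
  ext t
  simp [phiConv, opConv, phiOp]

theorem isKernel_phiOp (hβ : 0 < β) : ∃ K, IsKernel (phiOp X β) β K :=
  ⟨_, (isKernel_Phi hβ).clm_comp
    (ContinuousLinearMap.toSpanSingleton ℂ (ContinuousLinearMap.id ℂ X))⟩

theorem phiConv_congr (ht : 0 ≤ t) (hhk : EqOn h k (Ioo 0 t)) : phiConv β h t = phiConv β k t := by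
  simpa only [phiConv_eq_opConv] using opConv_congr ht hhk

theorem phiConv_one (f : ℝ → X) (ht : 0 ≤ t) : phiConv 1 f t = ∫ s in (0 : ℝ)..t, f s := by
  simp only [phiConv, intervalIntegral.integral_of_le ht, integral_Ioc_eq_integral_Ioo]
  exact setIntegral_congr_fun measurableSet_Ioo fun s hs => by
    simp only [Phi_one_of_pos (sub_pos.2 hs.2), one_smul]

theorem intervalIntegrable_phi_smul (hβ : 0 < β) (ht : 0 ≤ t) (hh : ContinuousOn h (Icc 0 t)) :
    IntervalIntegrable (fun s => Phi β (t - s) • h s) volume 0 t := by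
  obtain ⟨K, hK⟩ := isKernel_phiOp (X := X) hβ
  simpa [phiOp] using hK.intervalIntegrable_clm_apply_of_continuousOn ht hh

protected theorem IsKernel.intervalIntegrable_phi_smul (hβ : 0 < β) (hh : IsKernel h d M)
    (ht : 0 < t) : IntervalIntegrable (fun s => Phi β (t - s) • h s) volume 0 t := by
  obtain ⟨K, hK⟩ := isKernel_phiOp (X := X) hβ
  simpa [phiOp] using hK.intervalIntegrable_clm_apply hh ht

protected theorem IsKernel.continuousOn_phiConv (hβ : 0 < β) (hh : IsKernel h d M) :
    ContinuousOn (phiConv β h) (Ioi 0) := by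
  obtain ⟨K, hK⟩ := isKernel_phiOp (X := X) hβ
  rw [phiConv_eq_opConv]
  exact (hK.opConv hh).continuousOn

theorem continuousOn_phiConv (hβ : 0 < β) (hh : ContinuousOn h (Ico 0 T)) :
    ContinuousOn (phiConv β h) (Ico 0 T) := by
  obtain ⟨K, hK⟩ := isKernel_phiOp (X := X) hβ
  rw [phiConv_eq_opConv]
  exact hK.continuousOn_opConv hh

theorem phiConv_sub (hβ : 0 < β) (ht : 0 ≤ t) (hh : ContinuousOn h (Icc 0 t))
    (hk : ContinuousOn k (Icc 0 t)) :
    phiConv β (fun s => h s - k s) t = phiConv β h t - phiConv β k t := by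
  simp only [phiConv, smul_sub]
  exact intervalIntegral.integral_sub (intervalIntegrable_phi_smul hβ ht hh)
    (intervalIntegrable_phi_smul hβ ht hk)

theorem phiConv_clm_comp [CompleteSpace X] [CompleteSpace Y] (R : X →L[ℂ] Y) (hβ : 0 < β)
    (ht : 0 ≤ t) (hh : ContinuousOn h (Icc 0 t)) :
    phiConv β (fun s => R (h s)) t = R (phiConv β h t) := by
  rw [phiConv, phiConv, ← R.intervalIntegral_comp_comm (intervalIntegrable_phi_smul hβ ht hh)]
  simp only [← Complex.coe_smul, map_smul]

protected theorem HasLaplace.phiConv [CompleteSpace X] (hβ : 0 < β) (hf : HasLaplace f F) :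
    HasLaplace (phiConv β f) fun z => z ^ (-(β : ℂ)) • F z := by
  have hΦ : HasLaplace (phiOp X β) fun z => z ^ (-(β : ℂ)) • ContinuousLinearMap.id ℂ X :=
    (hasLaplace_Phi hβ).clm_comp
      (ContinuousLinearMap.toSpanSingleton ℂ (ContinuousLinearMap.id ℂ X))
  rw [phiConv_eq_opConv]
  exact hΦ.opConv hf

theorem HasLaplace.continuousOn_phiConv_one (hf : HasLaplace f F) :
    ContinuousOn (phiConv 1 f) (Ioi 0) := by
  intro t ht
  have hprim := intervalIntegral.continuousOn_primitive_interval
    ((intervalIntegrable_iff' (f := f) (a := 0) (b := t + 1)).1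
      (hf.intervalIntegrable (by linarith [mem_Ioi.1 ht])))
  rw [uIcc_of_le (by linarith [mem_Ioi.1 ht])] at hprim
  have hnhds : Icc 0 (t + 1) ∈ 𝓝 t := Icc_mem_nhds ht (lt_add_one t)
  refine ((hprim.continuousAt hnhds).congr ?_).continuousWithinAt
  filter_upwards [hnhds] with s hs using (phiConv_one f hs.1).symm

protected theorem IsKernel.phiConv_opConv [CompleteSpace X] [CompleteSpace Y] (ha : IsKernel a c K)
    (hβ : 0 < β) (hh : IsKernel h d M) :
    EqOn (phiConv β (opConv a h)) (opConv a (phiConv β h)) (Ioi 0) := by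
  obtain ⟨L, hL⟩ := isKernel_phiOp (X := X) hβ
  have hright := ha.hasLaplace.opConv (hh.hasLaplace.phiConv hβ)
  refine (((ha.hasLaplace.opConv hh.hasLaplace).phiConv hβ).congr_right fun z _ => ?_).eqOn hright
    ((ha.opConv hh).continuousOn_phiConv hβ) ?_
  · rw [map_smul]
  · rw [phiConv_eq_opConv]
    exact (ha.opConv (hL.opConv hh)).continuousOn

theorem phiConv_opConv [CompleteSpace X] [CompleteSpace Y] (ha : IsKernel a c K)
    (hβ : 0 < β) (ht : 0 ≤ t) (hh : ContinuousOn h (Icc 0 t)) :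
    phiConv β (opConv a h) t = opConv a (phiConv β h) t := by
  rcases ht.eq_or_lt with rfl | ht₀
  · simp [phiConv, opConv]
  obtain ⟨M, hM⟩ := IsKernel.comp_projIcc ht hh
  have heq : EqOn h (fun s => h (projIcc 0 t ht s)) (Icc 0 t) := fun s hs => by
    simp only [projIcc_of_mem ht hs]
  have heq' : ∀ s ∈ Ioo 0 t, EqOn h (fun s => h (projIcc 0 t ht s)) (Ioo 0 s) := fun s hs =>
    heq.mono (Ioo_subset_Icc_self.trans (Icc_subset_Icc_right hs.2.le))
  rw [phiConv_congr ht fun s hs => opConv_congr hs.1.le (heq' s hs),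
    opConv_congr ht fun s hs => phiConv_congr hs.1.le (heq' s hs)]
  exact ha.phiConv_opConv hβ hM ht₀

theorem hasLaplace_indicator_Ioo (hf : IntegrableOn f (Ioo 0 t)) :
    HasLaplace (indicator (Ioo 0 t) f) (laplace (indicator (Ioo 0 t) f)) := by
  refine ⟨fun z _ => ?_, fun _ _ => rfl⟩
  have hexp : ContinuousOn (fun s : ℝ => Complex.exp (-z * (s : ℂ))) (Icc 0 t) := by fun_prop
  have hf' : IntegrableOn f (Icc 0 t) := by rwa [integrableOn_Icc_iff_integrableOn_Ioo]
  have h := hf'.continuousOn_smul hexp isCompact_Icc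
  have h' := ((integrable_indicator_iff measurableSet_Ioo).2
    (h.mono_set Ioo_subset_Icc_self)).integrableOn (s := Ioi 0)
  refine h'.congr_fun (fun s _ => ?_) measurableSet_Ioi
  exact indicator_smul_apply _ _ _ s

theorem isKernel_phiConv_one_indicator (hf : IntegrableOn f (Ioo 0 t)) :
    IsKernel (phiConv 1 (indicator (Ioo 0 t) f)) 1 (∫ s, ‖indicator (Ioo 0 t) f s‖) where
  exponent_pos := one_pos
  continuousOn := (hasLaplace_indicator_Ioo hf).continuousOn_phiConv_one
  bound s hs := by
    have hint := ((integrable_indicator_iff measurableSet_Ioo).2 hf).norm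
    rw [phiConv_one _ (le_of_lt hs), sub_self, Real.rpow_zero, mul_one]
    exact (intervalIntegral.norm_integral_le_integral_norm_uIoc).trans
      (setIntegral_le_integral hint (ae_of_all _ fun _ => norm_nonneg _))

variable [CompleteSpace X]

theorem intervalIntegrable_phiConv (hβ : 0 < β) (ht : 0 ≤ t) (hf : IntegrableOn f (Ioo 0 t)) :
    IntervalIntegrable (phiConv β f) volume 0 t := by
  refine (intervalIntegrable_congr_Ioo ht fun s hs => ?_).2
    (((hasLaplace_indicator_Ioo hf).phiConv hβ).intervalIntegrable ht)
  exact phiConv_congr hs.1.le fun r hr =>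
    (indicator_of_mem (show r ∈ Ioo 0 t from ⟨hr.1, hr.2.trans hs.2⟩) f).symm

theorem phiConv_phiConv_one (hβ : 0 < β) (ht : 0 < t) (hf : IntegrableOn f (Ioo 0 t)) :
    phiConv β (phiConv 1 f) t = phiConv 1 (phiConv β f) t := by
  have heq : ∀ s ∈ Ioo 0 t, EqOn f (indicator (Ioo 0 t) f) (Ioo 0 s) := fun s hs r hr =>
    (indicator_of_mem (show r ∈ Ioo 0 t from ⟨hr.1, hr.2.trans hs.2⟩) f).symm
  rw [phiConv_congr ht.le fun s hs => phiConv_congr hs.1.le (heq s hs),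
    phiConv_congr ht.le fun s hs => phiConv_congr hs.1.le (heq s hs)]
  have hlap := hasLaplace_indicator_Ioo hf
  refine ((hlap.phiConv one_pos).phiConv hβ).eqOn
    (((hlap.phiConv hβ).phiConv one_pos).congr_right fun z _ => smul_comm _ _ _)
    ((isKernel_phiConv_one_indicator hf).continuousOn_phiConv hβ)
    (hlap.phiConv hβ).continuousOn_phiConv_one ht

end PhiConv

/-! ### The solution kernel -/

section Resolvent

variable {X : Type*} [NormedAddCommGroup X] [NormedSpace ℂ X] {A : X →ₗ.[ℂ] X}

theorem opApply_zero : opApply A 0 = 0 := by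
  rw [opApply, dif_pos A.domain.zero_mem]
  exact A.map_zero

theorem opApply_sub {x y : X} (hx : x ∈ A.domain) (hy : y ∈ A.domain) :
    opApply A (x - y) = opApply A x - opApply A y := by
  rw [opApply, opApply, opApply, dif_pos hx, dif_pos hy, dif_pos (A.domain.sub_mem hx hy),
    ← A.map_sub]
  rfl

theorem isResolventAt_res {z : ℂ} (hz : z ∈ resolventSet A) : IsResolventAt A z (res A z) := by
  have h : ∃ R : X →L[ℂ] X, IsResolventAt A z R := hz
  rw [res, dif_pos h]
  exact h.choose_spec

namespace IsResolventAt

variable {R S : X →L[ℂ] X} {z w : ℂ}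

theorem opApply_apply (hR : IsResolventAt A z R) (x : X) : opApply A (R x) = z • R x - x := by
  rw [eq_sub_iff_add_eq', ← eq_sub_iff_add_eq', eq_comm, sub_eq_iff_eq_add',
    ← sub_eq_iff_eq_add]
  exact (hR.1 x).2

theorem injective (hR : IsResolventAt A z R) (x : X) (hx : R x = 0) : x = 0 := by
  simpa [hx, opApply_zero] using (hR.1 x).2.symm

theorem apply_sub_eq_iff (hR : IsResolventAt A 1 R) {x y : X} :
    R (x - y) = x ↔ x ∈ A.domain ∧ opApply A x = y := by
  constructor
  · intro h
    have hdom := hR.1 (x - y)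
    rw [h, one_smul] at hdom
    exact ⟨hdom.1, sub_right_injective hdom.2⟩
  · rintro ⟨hx, rfl⟩
    simpa using hR.2 x hx

theorem comm (hR : IsResolventAt A z R) (hS : IsResolventAt A w S) (x : X) :
    R (S x) = S (R x) := by
  have hAR : opApply A (R (S x)) = w • R (S x) - R x := by
    have h := hR.2 _ (hS.1 x).1
    rw [hS.opApply_apply, map_sub, map_sub, map_smul, map_smul] at h
    rw [hR.opApply_apply]
    exact sub_eq_iff_eq_add.2 (sub_eq_iff_eq_add'.1 h)
  have h := hS.2 _ (hR.1 (S x)).1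
  rwa [hAR, sub_sub_cancel, eq_comm] at h

end IsResolventAt

theorem IsSectorial.hasDecay {θ₀ α : ℝ} (hA : IsSectorial A θ₀) (hα₀ : 0 < α) (hα₁ : α < 1) :
    ∃ C, HasDecay (fun z => res A (z ^ (α : ℂ))) (angleOne α θ₀) α C := by
  obtain ⟨C, hC, hbound⟩ := hA.bound
  have hmaps : MapsTo (fun z : ℂ => z ^ (α : ℂ)) (sector (angleOne α θ₀)) (sector θ₀) :=
    fun z hz => cpow_mem_sector hα₀ hA.angle_le hz
  refine ⟨C, angleOne_pos hα₀ hα₁ hA.angle_pos, angleOne_le _ _, hα₀, hC.le, ?_, fun z hz => ?_⟩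
  · exact hA.analytic.comp (differentiableOn_id.cpow_const
      fun z hz => sector_subset_slitPlane (angleOne_le _ _) hz) hmaps
  · refine (hbound _ (hmaps hz)).trans_eq ?_
    rw [Complex.norm_cpow_real, Real.rpow_neg (norm_nonneg _), div_eq_mul_inv]

/-- `P` behaves like the solution operator of `∂ₜ^α u = A u + g`: it is of size `t ^ (α - 1)`, and
its Laplace transform is the resolvent of `A` at `z ^ α`. -/
structure IsSolutionKernel (A : X →ₗ.[ℂ] X) (α M : ℝ) (P : ℝ → X →L[ℂ] X) : Prop where
  lt_one : α < 1
  isKernel : IsKernel P α M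
  isResolventAt : ∀ z : ℂ, 0 < z.re → IsResolventAt A (z ^ (α : ℂ)) (laplace P z)

theorem IsSectorial.isSolutionKernel [CompleteSpace X] {θ₀ α : ℝ} {γ : ℝ → ℂ}
    (hA : IsSectorial A θ₀) (hα₀ : 0 < α) (hα₁ : α < 1) (hγ : IsContour (angleOne α θ₀) γ) :
    ∃ M, IsSolutionKernel A α M (opP A α γ) := by
  obtain ⟨C, hL⟩ := hA.hasDecay hα₀ hα₁
  obtain ⟨M, hM⟩ := hL.isKernel_invLaplace hγ
  refine ⟨M, hα₁, hM, fun z hz => ?_⟩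
  have hlap : laplace (opP A α γ) z = res A (z ^ (α : ℂ)) := hL.laplace_invLaplace hγ hz
  have hzα := cpow_mem_sector hα₀ hA.angle_le (mem_sector_of_re_pos hL.angle_pos hz)
  exact hlap ▸ isResolventAt_res (hA.subset_resolventSet hzα)

end Resolvent

section KernelIdentities

variable {X : Type*} [NormedAddCommGroup X] [NormedSpace ℂ X] {A : X →ₗ.[ℂ] X}
  {P : ℝ → X →L[ℂ] X} {h : ℝ → X} {α c d K L M t : ℝ}

theorem laplace_congr {f g : ℝ → X} (hfg : EqOn f g (Ioi 0)) : laplace f = laplace g := by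
  ext z
  exact setIntegral_congr_fun measurableSet_Ioi fun t ht => by simp only [hfg ht]

theorem IsResolventAt.apply_laplace [CompleteSpace X] {R : X →L[ℂ] X} {w z : ℂ}
    (hR : IsResolventAt A w R) (hz : 0 < z.re) (hh : IsKernel h c K)
    (hAh : IsKernel (fun s => opApply A (h s)) d L) (hdom : ∀ s > 0, h s ∈ A.domain) :
    R (w • laplace h z - laplace (fun s => opApply A (h s)) z) = laplace h z := by
  have hsmul := hh.hasLaplace.clm_comp (w • ContinuousLinearMap.id ℂ X)
  have hlap := (hsmul.sub hAh.hasLaplace).clm_comp R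
  have hcongr := laplace_congr (f := fun s => R (w • h s - opApply A (h s))) (g := h)
    fun s hs => hR.2 _ (hdom s hs)
  exact (hlap.laplace_eq z hz).symm.trans (congrFun hcongr z)

namespace IsSolutionKernel

theorem isResolventAt_one (hP : IsSolutionKernel A α M P) : IsResolventAt A 1 (laplace P 1) := by
  simpa using hP.isResolventAt 1 (by simp)

theorem one_sub_pos (hP : IsSolutionKernel A α M P) : 0 < 1 - α :=
  sub_pos.2 hP.lt_one

variable [CompleteSpace X]

theorem apply_opConv_sub (hP : IsSolutionKernel A α M P) (hh : IsKernel h c K)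
    (hAh : IsKernel (fun s => opApply A (h s)) d L) (hdom : ∀ s > 0, h s ∈ A.domain) :
    EqOn (fun t => laplace P 1 (opConv P h t - opConv P (fun s => opApply A (h s)) t))
      (opConv P h) (Ioi 0) := by
  have hPh := hP.isKernel.opConv hh
  have hPAh := hP.isKernel.opConv hAh
  have hlap := (hP.isKernel.hasLaplace.opConv hh.hasLaplace).sub
    (hP.isKernel.hasLaplace.opConv hAh.hasLaplace)
  refine ((hlap.clm_comp (laplace P 1)).congr_right fun z hz => ?_).eqOn
    (hP.isKernel.hasLaplace.opConv hh.hasLaplace)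
    ((laplace P 1).continuous.comp_continuousOn (hPh.continuousOn.sub hPAh.continuousOn))
    hPh.continuousOn
  have hR := hP.isResolventAt_one.apply_laplace hz hh hAh hdom
  rw [one_smul] at hR
  rw [← map_sub, hP.isResolventAt_one.comm (hP.isResolventAt z hz), hR]

theorem phiConv_opConv_eqOn (hP : IsSolutionKernel A α M P) (hh : IsKernel h c K)
    (hAh : IsKernel (fun s => opApply A (h s)) d L) (hdom : ∀ s > 0, h s ∈ A.domain) :
    EqOn (phiConv (1 - α) (opConv P h))
      (fun t => phiConv 1 h t + phiConv 1 (opConv P fun s => opApply A (h s)) t) (Ioi 0) := by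
  have hPh := hP.isKernel.opConv hh
  have hPAh := hP.isKernel.opConv hAh
  have hleft := (hP.isKernel.hasLaplace.opConv hh.hasLaplace).phiConv hP.one_sub_pos
  have hright := (hh.hasLaplace.phiConv one_pos).add
    ((hP.isKernel.hasLaplace.opConv hAh.hasLaplace).phiConv one_pos)
  refine (hleft.congr_right fun z hz => ?_).eqOn hright (hPh.continuousOn_phiConv hP.one_sub_pos)
    ((hh.continuousOn_phiConv one_pos).add (hPAh.continuousOn_phiConv one_pos))
  have hz₀ : z ≠ 0 := by
    rintro rfl
    simp at hz
  have hpow : z ^ (-((1 - α : ℝ) : ℂ)) = z ^ (-((1 : ℝ) : ℂ)) * z ^ (α : ℂ) := by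
    rw [← Complex.cpow_add _ _ hz₀]
    push_cast
    ring_nf
  have hres := (hP.isResolventAt z hz).apply_laplace hz hh hAh hdom
  rw [map_sub, map_smul, sub_eq_iff_eq_add] at hres
  rw [hpow, mul_smul, hres, smul_add]

theorem apply_opConv (hP : IsSolutionKernel A α M P) (ht : 0 ≤ t)
    (hh : ContinuousOnDomain A h (Icc 0 t)) :
    opConv P h t ∈ A.domain ∧
      opApply A (opConv P h t) = opConv P (fun s => opApply A (h s)) t := by
  rw [← hP.isResolventAt_one.apply_sub_eq_iff]
  rcases ht.eq_or_lt with rfl | ht₀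
  · simp [opConv]
  obtain ⟨K, hK⟩ := IsKernel.comp_projIcc ht hh.2.fst
  obtain ⟨L, hL⟩ := IsKernel.comp_projIcc ht hh.2.snd
  have hproj : ∀ s ∈ Ioo 0 t, h s = h (projIcc 0 t ht s) := fun s hs => by
    rw [projIcc_of_mem ht (Ioo_subset_Icc_self hs)]
  rw [opConv_congr ht hproj, opConv_congr ht fun s hs => congrArg (opApply A) (hproj s hs)]
  exact hP.apply_opConv_sub hK hL (fun s _ => hh.1 _ (projIcc 0 t ht s).2) ht₀

protected theorem phiConv_opConv (hP : IsSolutionKernel A α M P) (ht : 0 ≤ t)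
    (hh : ContinuousOnDomain A h (Icc 0 t)) :
    phiConv (1 - α) (opConv P h) t =
      phiConv 1 h t + phiConv 1 (opConv P fun s => opApply A (h s)) t := by
  rcases ht.eq_or_lt with rfl | ht₀
  · simp [phiConv]
  obtain ⟨K, hK⟩ := IsKernel.comp_projIcc ht hh.2.fst
  obtain ⟨L, hL⟩ := IsKernel.comp_projIcc ht hh.2.snd
  have hproj : ∀ s ∈ Ioo 0 t, h s = h (projIcc 0 t ht s) := fun s hs => by
    rw [projIcc_of_mem ht (Ioo_subset_Icc_self hs)]
  have hproj' : ∀ s ∈ Ioo 0 t, ∀ r ∈ Ioo 0 s, h r = h (projIcc 0 t ht r) := fun s hs r hr =>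
    hproj r ⟨hr.1, hr.2.trans hs.2⟩
  rw [phiConv_congr ht hproj, phiConv_congr ht fun s hs => opConv_congr hs.1.le (hproj' s hs),
    phiConv_congr ht fun s hs => opConv_congr hs.1.le
      fun r hr => congrArg (opApply A) (hproj' s hs r hr)]
  exact hP.phiConv_opConv_eqOn hK hL (fun s _ => hh.1 _ (projIcc 0 t ht s).2) ht₀

end IsSolutionKernel

end KernelIdentities

/-! ### Well-posedness -/

section Calculus

variable {X : Type*} [NormedAddCommGroup X] [NormedSpace ℂ X] {f u : ℝ → X} {β t T : ℝ}

theorem Icc_subset_Ico_of_mem (ht : t ∈ Ico 0 T) : Icc 0 t ⊆ Ico 0 T :=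
  fun _ hs => ⟨hs.1, hs.2.trans_lt ht.2⟩

theorem intervalIntegrable_of_continuousOn_Ico {E : Type*} [NormedAddCommGroup E] {f : ℝ → E}
    (hf : ContinuousOn f (Ico 0 T)) (ht : t ∈ Ico 0 T) : IntervalIntegrable f volume 0 t :=
  (hf.mono (by rw [uIcc_of_le ht.1]; exact Icc_subset_Ico_of_mem ht)).intervalIntegrable

theorem hasDerivAt_phiConv_one [CompleteSpace X] (hf : ContinuousOn f (Ioo 0 T))
    (hi : IntervalIntegrable f volume 0 t) (ht : t ∈ Ioo 0 T) :
    HasDerivAt (phiConv 1 f) (f t) t := by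
  refine (intervalIntegral.integral_hasDerivAt_right hi
    (hf.stronglyMeasurableAtFilter isOpen_Ioo t ht)
    (hf.continuousAt (isOpen_Ioo.mem_nhds ht))).congr_of_eventuallyEq ?_
  filter_upwards [isOpen_Ioo.mem_nhds ht] with s hs using phiConv_one f hs.1.le

theorem eq_phiConv_one_deriv [CompleteSpace X] (hu : ContinuousOn u (Icc 0 t)) (hu₀ : u 0 = 0)
    (hd : ∀ s ∈ Ioo 0 t, DifferentiableAt ℝ u s) (hi : IntegrableOn (deriv u) (Ioo 0 t))
    (ht : 0 ≤ t) : u t = phiConv 1 (deriv u) t := by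
  rw [phiConv_one _ ht, intervalIntegral.integral_eq_sub_of_hasDerivAt_of_le ht hu
    (fun s hs => (hd s hs).hasDerivAt)
    ((intervalIntegrable_iff_integrableOn_Ioo_of_le ht).2 hi), hu₀, sub_zero]

theorem hasDerivAt_phiConv [CompleteSpace X] (hβ : 0 < β) (hu : ContinuousOn u (Ico 0 T))
    (hu₀ : u 0 = 0) (hd : ∀ s ∈ Ioo 0 T, DifferentiableAt ℝ u s)
    (hi : ∀ s ∈ Ioo 0 T, IntegrableOn (deriv u) (Ioo 0 s))
    (hc : ContinuousOn (phiConv β (deriv u)) (Ioo 0 T)) (ht : t ∈ Ioo 0 T) :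
    HasDerivAt (phiConv β u) (phiConv β (deriv u) t) t := by
  have hprim : ∀ s ∈ Ioo 0 T, u s = phiConv 1 (deriv u) s := fun s hs =>
    eq_phiConv_one_deriv (hu.mono (Icc_subset_Ico_of_mem (Ioo_subset_Ico_self hs))) hu₀
      (fun r hr => hd r ⟨hr.1, hr.2.trans hs.2⟩) (hi s hs) hs.1.le
  refine (hasDerivAt_phiConv_one hc
    (intervalIntegrable_phiConv hβ ht.1.le (hi t ht)) ht).congr_of_eventuallyEq ?_
  filter_upwards [isOpen_Ioo.mem_nhds ht] with s hs
  rw [← phiConv_phiConv_one hβ hs.1 (hi s hs)]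
  exact phiConv_congr hs.1.le fun r hr => hprim r ⟨hr.1, hr.2.trans hs.2⟩

theorem hasDerivWithinAt_phiConv_one [CompleteSpace X] (hf : ContinuousOn f (Ico 0 T))
    (ht : t ∈ Ico 0 T) : HasDerivWithinAt (phiConv 1 f) (f t) (Ico 0 T) t := by
  obtain ⟨T', htT', hT'⟩ := exists_between ht.2
  have hT'₀ : 0 ≤ T' := ht.1.trans htT'.le
  have hext : Continuous (IccExtend hT'₀ ((Icc 0 T').domRestrict f)) :=
    (continuousOn_iff_continuous_domRestrict.1
      (hf.mono fun s hs => ⟨hs.1, hs.2.trans_lt hT'⟩)).Icc_extend'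
  have heq : EqOn (IccExtend hT'₀ ((Icc 0 T').domRestrict f)) f (Icc 0 T') :=
    fun s hs => IccExtend_of_mem hT'₀ _ hs
  have hprim : ∀ s ∈ Icc 0 T',
      phiConv 1 f s = ∫ r in (0 : ℝ)..s, IccExtend hT'₀ ((Icc 0 T').domRestrict f) r :=
    fun s hs => by
      rw [phiConv_one f hs.1]
      refine (intervalIntegral.integral_congr fun r hr => heq ?_).symm
      rw [uIcc_of_le hs.1] at hr
      exact ⟨hr.1, hr.2.trans hs.2⟩
  have htm : t ∈ Icc 0 T' := ⟨ht.1, htT'.le⟩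
  have hderiv := (hext.integral_hasStrictDerivAt 0 t).hasDerivAt.hasDerivWithinAt (s := Ico 0 T)
  rw [heq htm] at hderiv
  refine hderiv.congr_of_eventuallyEq ?_ (hprim t htm)
  filter_upwards [self_mem_nhdsWithin, mem_nhdsWithin_of_mem_nhds (gt_mem_nhds htT')] with s hs hs'
  exact hprim s ⟨hs.1, hs'.le⟩

theorem contDiffOn_phiConv_one [CompleteSpace X] (hf : ContinuousOn f (Ico 0 T)) :
    ContDiffOn ℝ 1 (phiConv 1 f) (Ico 0 T) := by
  rw [contDiffOn_one_iff_derivWithin (uniqueDiffOn_Ico 0 T)]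
  refine ⟨fun t ht => (hasDerivWithinAt_phiConv_one hf ht).differentiableWithinAt,
    hf.congr fun t ht => ?_⟩
  exact (hasDerivWithinAt_phiConv_one hf ht).derivWithin (uniqueDiffOn_Ico 0 T t ht)

theorem eq_add_phiConv_one_derivWithin [CompleteSpace X] (hf : ContDiffOn ℝ 1 f (Ico 0 T))
    (ht : t ∈ Ico 0 T) : f t = f 0 + phiConv 1 (derivWithin f (Ico 0 T)) t := by
  obtain ⟨hdiff, hcont⟩ := (contDiffOn_one_iff_derivWithin (uniqueDiffOn_Ico 0 T)).1 hf
  rw [phiConv_one _ ht.1, intervalIntegral.integral_eq_sub_of_hasDerivAt_of_le ht.1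
    (hf.continuousOn.mono (Icc_subset_Ico_of_mem ht)) (fun s hs => ?_)
    (intervalIntegrable_of_continuousOn_Ico hcont ht), add_sub_cancel]
  have hs' : s ∈ Ioo 0 T := ⟨hs.1, hs.2.trans ht.2⟩
  exact (hdiff s (Ioo_subset_Ico_self hs')).hasDerivWithinAt.hasDerivAt
    (mem_of_superset (isOpen_Ioo.mem_nhds hs') Ioo_subset_Ico_self)

end Calculus

section Caputo

variable {X : Type*} [NormedAddCommGroup X] [NormedSpace ℂ X] {A : X →ₗ.[ℂ] X}
  {f g u v : ℝ → X} {α t T : ℝ}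

theorem rpow_neg_eq_Gamma_mul_Phi {r : ℝ} (hα : α < 1) (hr : 0 < r) :
    r ^ (-α) = Real.Gamma (1 - α) * Phi (1 - α) r := by
  have hΓ := (Real.Gamma_pos_of_pos (sub_pos.2 hα)).ne'
  rw [Phi_of_pos hr, show 1 - α - 1 = -α by ring]
  field_simp

theorem caputoDeriv_eq_phiConv (hα : α < 1) (u : ℝ → X) (ht : 0 ≤ t) :
    caputoDeriv α u t = phiConv (1 - α) (deriv u) t := by
  have hΓ := (Real.Gamma_pos_of_pos (sub_pos.2 hα)).ne'
  rw [caputoDeriv, phiConv, ← intervalIntegral.integral_smul,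
    intervalIntegral.integral_of_le ht, intervalIntegral.integral_of_le ht,
    integral_Ioc_eq_integral_Ioo, integral_Ioc_eq_integral_Ioo]
  refine setIntegral_congr_fun measurableSet_Ioo fun s hs => ?_
  simp only [rpow_neg_eq_Gamma_mul_Phi hα (sub_pos.2 hs.2), smul_smul]
  congr 1
  field_simp

theorem intervalIntegrable_rpow_neg_smul (hα : α < 1) (ht : 0 ≤ t)
    (hf : IntervalIntegrable (fun s => Phi (1 - α) (t - s) • f s) volume 0 t) :
    IntervalIntegrable (fun s => (t - s) ^ (-α) • f s) volume 0 t := by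
  refine (intervalIntegrable_congr_Ioo ht fun s hs => ?_).2 (hf.smul (Real.Gamma (1 - α)))
  simp only [rpow_neg_eq_Gamma_mul_Phi hα (sub_pos.2 hs.2), mul_smul, Pi.smul_apply]

theorem integrableOn_of_rpow_neg_smul (hα : 0 ≤ α) (ht : 0 ≤ t)
    (hf : IntervalIntegrable (fun s => (t - s) ^ (-α) • f s) volume 0 t) :
    IntegrableOn f (Ioo 0 t) := by
  rw [intervalIntegrable_iff_integrableOn_Icc_of_le ht] at hf
  have hcont : ContinuousOn (fun s : ℝ => (t - s) ^ α) (Icc 0 t) :=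
    (continuousOn_const.sub continuousOn_id).rpow_const fun _ _ => Or.inr hα
  refine ((hf.continuousOn_smul hcont isCompact_Icc).mono_set Ioo_subset_Icc_self).congr_fun
    (fun s hs => ?_) measurableSet_Ioo
  simp only [smul_smul]
  rw [← Real.rpow_add (sub_pos.2 hs.2), add_neg_cancel, Real.rpow_zero, one_smul]

theorem ContinuousOnDomain.mono {I J : Set ℝ} (hf : ContinuousOnDomain A f J) (hIJ : I ⊆ J) :
    ContinuousOnDomain A f I :=
  ⟨fun t ht => hf.1 t (hIJ ht), hf.2.mono hIJ⟩

theorem HasStrongRegularity.interior (hu : HasStrongRegularity A α (Ico 0 T) u₀ u) :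
    HasStrongRegularity A α (Ioo 0 T) u₀ u :=
  ⟨hu.initial, hu.continuousOn.mono (insert_subset_insert Ioo_subset_Ico_self),
    hu.domain.mono Ioo_subset_Ico_self, hu.conv_c1.mono Ioo_subset_Ico_self⟩

theorem HasStrongRegularity.continuousOn_Ico (hu : HasStrongRegularity A α (Ioo 0 T) u₀ u)
    (hT : 0 < T) : ContinuousOn u (Ico 0 T) :=
  Ioo_insert_left hT ▸ hu.continuousOn

theorem IsRegularizedStrongSolution.hasDerivAt
    (hu : IsRegularizedStrongSolution A α T 0 g u) (ht : t ∈ Ioo 0 T) :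
    HasDerivAt (phiConv (1 - α) u) (opApply A (u t) + g t) t := by
  have hdiff := (hu.regularity.conv_c1.differentiableOn one_ne_zero).differentiableAt
    (isOpen_Ioo.mem_nhds ht)
  rw [← hu.equation t ht]
  simpa only [sub_zero] using hdiff.hasDerivAt

variable [CompleteSpace X]

theorem IsStrongSolution.isRegularizedStrongSolution (hα₀ : 0 ≤ α) (hα₁ : α < 1)
    (hg : ContinuousOn g (Ioo 0 T)) (hu : IsStrongSolution A α T 0 g u) :
    IsRegularizedStrongSolution A α T 0 g u := by
  refine ⟨hu.regularity, fun t ht => ?_⟩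
  have hcaputo : ∀ s ∈ Ioo 0 T, phiConv (1 - α) (deriv u) s = opApply A (u s) + g s :=
    fun s hs => by rw [← caputoDeriv_eq_phiConv hα₁ u hs.1.le, hu.equation s hs]
  simp only [sub_zero]
  rw [← hcaputo t ht]
  exact (hasDerivAt_phiConv (sub_pos.2 hα₁)
    (hu.regularity.continuousOn_Ico (ht.1.trans ht.2)) hu.regularity.initial hu.differentiable
    (fun s hs => integrableOn_of_rpow_neg_smul hα₀ hs.1.le (hu.integrable s hs))
    ((hu.regularity.domain.2.snd.add hg).congr hcaputo) ht).deriv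

theorem IsRegularizedStrongSolution.isStrongSolution (hα₀ : 0 ≤ α) (hα₁ : α < 1)
    (hu : IsRegularizedStrongSolution A α T 0 g u) (hd : ∀ t ∈ Ioo 0 T, DifferentiableAt ℝ u t)
    (hi : ∀ t ∈ Ioo 0 T,
      IntervalIntegrable (fun s => Phi (1 - α) (t - s) • deriv u s) volume 0 t)
    (hc : ContinuousOn (phiConv (1 - α) (deriv u)) (Ioo 0 T)) :
    IsStrongSolution A α T 0 g u := by
  have hrpow : ∀ t ∈ Ioo 0 T,
      IntervalIntegrable (fun s => (t - s) ^ (-α) • deriv u s) volume 0 t :=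
    fun t ht => intervalIntegrable_rpow_neg_smul hα₁ ht.1.le (hi t ht)
  refine ⟨hu.regularity, hd, hrpow, fun t ht => ?_⟩
  rw [caputoDeriv_eq_phiConv hα₁ u ht.1.le]
  exact (hasDerivAt_phiConv (sub_pos.2 hα₁)
    (hu.regularity.continuousOn_Ico (ht.1.trans ht.2)) hu.regularity.initial hd
    (fun s hs => integrableOn_of_rpow_neg_smul hα₀ hs.1.le (hrpow s hs)) hc ht).unique
    (hu.hasDerivAt ht)

end Caputo

namespace IsKernel

variable {X Y : Type*} [NormedAddCommGroup X] [NormedSpace ℂ X] [CompleteSpace X]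
  [NormedAddCommGroup Y] [NormedSpace ℂ Y] [CompleteSpace Y]
  {a : ℝ → X →L[ℂ] Y} {g : ℝ → X} {β c K t T : ℝ}

theorem opConv_eq_phiConv_one (ha : IsKernel a c K) (hg : ContDiffOn ℝ 1 g (Ico 0 T))
    (ht : t ∈ Ico 0 T) :
    opConv a g t =
      phiConv 1 (fun s => a s (g 0) + opConv a (derivWithin g (Ico 0 T)) s) t := by
  have hsub := Icc_subset_Ico_of_mem ht
  have hg' := hg.continuousOn_derivWithin (uniqueDiffOn_Ico 0 T) le_rfl
  have hprim := (continuousOn_phiConv one_pos hg').mono hsub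
  rw [opConv_congr ht.1 fun s hs =>
      eq_add_phiConv_one_derivWithin hg (hsub (Ioo_subset_Icc_self hs)),
    opConv_add (ha.intervalIntegrable_clm_apply_of_continuousOn ht.1 continuousOn_const)
      (ha.intervalIntegrable_clm_apply_of_continuousOn ht.1 hprim),
    opConv_const, ← phiConv_opConv ha one_pos ht.1 (hg'.mono hsub),
    phiConv_one _ ht.1, phiConv_one _ ht.1]
  exact (intervalIntegral.integral_add ((ha.clm_apply _).hasLaplace.intervalIntegrable ht.1)
    (intervalIntegrable_of_continuousOn_Ico (ha.continuousOn_opConv hg') ht)).symm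

theorem hasDerivAt_opConv (ha : IsKernel a c K) (hg : ContDiffOn ℝ 1 g (Ico 0 T))
    (ht : t ∈ Ioo 0 T) :
    HasDerivAt (opConv a g) (a t (g 0) + opConv a (derivWithin g (Ico 0 T)) t) t := by
  have hg' := hg.continuousOn_derivWithin (uniqueDiffOn_Ico 0 T) le_rfl
  have hcont : ContinuousOn (fun s => a s (g 0) + opConv a (derivWithin g (Ico 0 T)) s)
      (Ioo 0 T) :=
    ((ha.clm_apply _).continuousOn.mono Ioo_subset_Ioi_self).add
      ((ha.continuousOn_opConv hg').mono Ioo_subset_Ico_self)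
  have hint := ((ha.clm_apply (g 0)).hasLaplace.intervalIntegrable ht.1.le).add
    (intervalIntegrable_of_continuousOn_Ico (ha.continuousOn_opConv hg') (Ioo_subset_Ico_self ht))
  refine (hasDerivAt_phiConv_one hcont hint ht).congr_of_eventuallyEq ?_
  filter_upwards [isOpen_Ioo.mem_nhds ht] with s hs
  exact ha.opConv_eq_phiConv_one hg (Ioo_subset_Ico_self hs)

theorem intervalIntegrable_phi_smul_deriv_opConv (ha : IsKernel a c K) (hβ : 0 < β)
    (hg : ContDiffOn ℝ 1 g (Ico 0 T)) (ht : t ∈ Ioo 0 T) :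
    IntervalIntegrable (fun s => Phi β (t - s) • deriv (opConv a g) s) volume 0 t := by
  have hg' := hg.continuousOn_derivWithin (uniqueDiffOn_Ico 0 T) le_rfl
  refine (intervalIntegrable_congr_Ioo ht.1.le fun s hs => ?_).2
    (((ha.clm_apply (g 0)).intervalIntegrable_phi_smul hβ ht.1).add
      (intervalIntegrable_phi_smul hβ ht.1.le
        ((ha.continuousOn_opConv hg').mono (Icc_subset_Ico_of_mem (Ioo_subset_Ico_self ht)))))
  simp only [(ha.hasDerivAt_opConv hg ⟨hs.1, hs.2.trans ht.2⟩).deriv, smul_add]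

theorem continuousOn_phiConv_deriv_opConv (ha : IsKernel a c K) (hβ : 0 < β)
    (hg : ContDiffOn ℝ 1 g (Ico 0 T)) :
    ContinuousOn (phiConv β (deriv (opConv a g))) (Ioo 0 T) := by
  have hg' := hg.continuousOn_derivWithin (uniqueDiffOn_Ico 0 T) le_rfl
  have hx := ha.clm_apply (g 0)
  have hPg' := ha.continuousOn_opConv hg'
  refine (((hx.continuousOn_phiConv hβ).mono Ioo_subset_Ioi_self).add
    ((continuousOn_phiConv hβ hPg').mono Ioo_subset_Ico_self)).congr
      fun t ht => ?_
  rw [phiConv_congr ht.1.le fun s hs =>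
    (ha.hasDerivAt_opConv hg ⟨hs.1, hs.2.trans ht.2⟩).deriv]
  simp only [phiConv, smul_add]
  exact intervalIntegral.integral_add (hx.intervalIntegrable_phi_smul hβ ht.1)
    (intervalIntegrable_phi_smul hβ ht.1.le
      (hPg'.mono (Icc_subset_Ico_of_mem (Ioo_subset_Ico_self ht))))

end IsKernel

theorem IsResolventAt.phiConv_apply_eqOn {X : Type*} [NormedAddCommGroup X] [NormedSpace ℂ X]
    [CompleteSpace X] {A : X →ₗ.[ℂ] X} {R : X →L[ℂ] X} {w : ℝ → X} {β T : ℝ}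
    (hR : IsResolventAt A 1 R) (hβ : 0 < β) (hw : ContinuousOn w (Ico 0 T))
    (hdom : ∀ t ∈ Ioo 0 T, w t ∈ A.domain)
    (hd : ∀ t ∈ Ioo 0 T, HasDerivAt (phiConv β w) (opApply A (w t)) t) :
    EqOn (phiConv β fun s => R (w s)) (phiConv 1 fun s => R (w s) - w s) (Ico 0 T) := by
  intro t ht
  have hsub := Icc_subset_Ico_of_mem ht
  have hRw : ContinuousOn (fun s => R (w s)) (Ico 0 T) := R.continuous.comp_continuousOn hw
  have hRA : ∀ s ∈ Ioo 0 T, R (opApply A (w s)) = R (w s) - w s := fun s hs => by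
    have h := hR.2 _ (hdom s hs)
    rwa [one_smul, map_sub, sub_eq_iff_eq_add, ← sub_eq_iff_eq_add', eq_comm] at h
  have hderiv : ∀ s ∈ Ioo 0 t,
      HasDerivAt (phiConv β fun r => R (w r)) (R (w s) - w s) s := fun s hs => by
    have hs' : s ∈ Ioo 0 T := ⟨hs.1, hs.2.trans_le ht.2.le⟩
    rw [← hRA s hs']
    refine ((R.restrictScalars ℝ).hasFDerivAt.comp_hasDerivAt s (hd s hs')).congr_of_eventuallyEq ?_
    filter_upwards [isOpen_Ioo.mem_nhds hs'] with r hr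
    exact phiConv_clm_comp R hβ hr.1.le
      (hw.mono (Icc_subset_Ico_of_mem (Ioo_subset_Ico_self hr)))
  have hftc := intervalIntegral.integral_eq_sub_of_hasDerivAt_of_le ht.1
    ((continuousOn_phiConv hβ hRw).mono hsub) hderiv
    (intervalIntegrable_of_continuousOn_Ico (hRw.sub hw) ht)
  have hzero : phiConv β (fun r => R (w r)) 0 = 0 := intervalIntegral.integral_same
  rw [phiConv_one _ ht.1, hftc, hzero, sub_zero]

namespace IsSolutionKernel

variable {X : Type*} [NormedAddCommGroup X] [NormedSpace ℂ X] [CompleteSpace X]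
  {A : X →ₗ.[ℂ] X} {P : ℝ → X →L[ℂ] X} {g h u v w : ℝ → X} {α M t T : ℝ}

theorem phiConv_opConv_eqOn_Ico (hP : IsSolutionKernel A α M P)
    (hg : ContinuousOnDomain A g (Ico 0 T)) :
    EqOn (phiConv (1 - α) (opConv P g))
      (phiConv 1 fun s => opConv P (fun r => opApply A (g r)) s + g s) (Ico 0 T) := by
  intro t ht
  have hsub := Icc_subset_Ico_of_mem ht
  have hPAg := hP.isKernel.continuousOn_opConv hg.2.snd
  rw [hP.phiConv_opConv ht.1 (hg.mono hsub),
    phiConv_one _ ht.1, phiConv_one _ ht.1, phiConv_one _ ht.1, add_comm]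
  exact (intervalIntegral.integral_add (intervalIntegrable_of_continuousOn_Ico hPAg ht)
    (intervalIntegrable_of_continuousOn_Ico hg.2.fst ht)).symm

theorem hasStrongRegularity (hP : IsSolutionKernel A α M P)
    (hg : ContinuousOnDomain A g (Ico 0 T)) (hT : 0 < T) :
    HasStrongRegularity A α (Ico 0 T) 0 (opConv P g) := by
  have hPg := hP.isKernel.continuousOn_opConv hg.2.fst
  have hPAg := hP.isKernel.continuousOn_opConv hg.2.snd
  have hdom : ∀ t ∈ Ico 0 T, opConv P g t ∈ A.domain ∧
      opApply A (opConv P g t) = opConv P (fun s => opApply A (g s)) t := fun t ht =>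
    hP.apply_opConv ht.1 (hg.mono (Icc_subset_Ico_of_mem ht))
  refine ⟨by simp [opConv], ?_, ⟨fun t ht => (hdom t ht).1,
    hPg.prodMk (hPAg.congr fun t ht => (hdom t ht).2)⟩, ?_⟩
  · rwa [insert_eq_of_mem (left_mem_Ico.2 hT)]
  · simp only [sub_zero]
    exact (contDiffOn_phiConv_one (hPAg.add hg.2.fst)).congr (hP.phiConv_opConv_eqOn_Ico hg)

theorem isRegularizedStrongSolution (hP : IsSolutionKernel A α M P)
    (hg : ContinuousOnDomain A g (Ico 0 T)) (hT : 0 < T) :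
    IsRegularizedStrongSolution A α T 0 g (opConv P g) := by
  refine ⟨(hP.hasStrongRegularity hg hT).interior, fun t ht => ?_⟩
  have ht' := Ioo_subset_Ico_self ht
  have hcont := (hP.isKernel.continuousOn_opConv hg.2.snd).add hg.2.fst
  simp only [sub_zero]
  rw [(hP.apply_opConv ht.1.le (hg.mono (Icc_subset_Ico_of_mem ht'))).2]
  refine HasDerivAt.deriv (((hasDerivAt_phiConv_one (hcont.mono Ioo_subset_Ico_self)
    (intervalIntegrable_of_continuousOn_Ico hcont ht') ht)).congr_of_eventuallyEq ?_)
  filter_upwards [isOpen_Ioo.mem_nhds ht] with s hs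
  exact hP.phiConv_opConv_eqOn_Ico hg (Ioo_subset_Ico_self hs)

theorem isStrongSolution (hP : IsSolutionKernel A α M P) (hg : ContinuousOnDomain A g (Ico 0 T))
    (hg' : ContDiffOn ℝ 1 g (Ico 0 T)) (hT : 0 < T) :
    IsStrongSolution A α T 0 g (opConv P g) :=
  (hP.isRegularizedStrongSolution hg hT).isStrongSolution hP.isKernel.exponent_pos.le hP.lt_one
    (fun _ ht => (hP.isKernel.hasDerivAt_opConv hg' ht).differentiableAt)
    (fun _ ht => hP.isKernel.intervalIntegrable_phi_smul_deriv_opConv hP.one_sub_pos hg' ht)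
    (hP.isKernel.continuousOn_phiConv_deriv_opConv hP.one_sub_pos hg')

theorem eqOn_zero_of_phiConv_eqOn (hP : IsSolutionKernel A α M P)
    (hh : ContinuousOnDomain A h (Ico 0 T))
    (heq : EqOn (phiConv (1 - α) h) (phiConv 1 fun s => opApply A (h s)) (Ico 0 T)) :
    EqOn h 0 (Ioo 0 T) := by
  have hzero : EqOn (phiConv 1 h) 0 (Ico 0 T) := fun t ht => by
    have hsub := Icc_subset_Ico_of_mem ht
    have hPh := hP.phiConv_opConv ht.1 (hh.mono hsub)
    rw [phiConv_opConv hP.isKernel hP.one_sub_pos ht.1 (hh.2.fst.mono hsub),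
      opConv_congr ht.1 (heq.mono (Ioo_subset_Icc_self.trans hsub)),
      ← phiConv_opConv hP.isKernel one_pos ht.1 (hh.2.snd.mono hsub)] at hPh
    exact right_eq_add.1 hPh
  intro t ht
  refine (hasDerivAt_phiConv_one (hh.2.fst.mono Ioo_subset_Ico_self)
    (intervalIntegrable_of_continuousOn_Ico hh.2.fst (Ioo_subset_Ico_self ht)) ht).unique
      ((hasDerivAt_const t (0 : X)).congr_of_eventuallyEq ?_)
  filter_upwards [isOpen_Ioo.mem_nhds ht] with s hs using hzero (Ioo_subset_Ico_self hs)

theorem eqOn_zero_of_hasDerivAt (hP : IsSolutionKernel A α M P) (hw : ContinuousOn w (Ico 0 T))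
    (hdom : ∀ t ∈ Ioo 0 T, w t ∈ A.domain)
    (hd : ∀ t ∈ Ioo 0 T, HasDerivAt (phiConv (1 - α) w) (opApply A (w t)) t) :
    EqOn w 0 (Ioo 0 T) := by
  have hR := hP.isResolventAt_one
  have hAR : (fun s => opApply A (laplace P 1 (w s))) = fun s => laplace P 1 (w s) - w s := by
    ext s
    rw [hR.opApply_apply, one_smul]
  have hRw : ContinuousOn (fun s => laplace P 1 (w s)) (Ico 0 T) :=
    (laplace P 1).continuous.comp_continuousOn hw
  have hzero := hP.eqOn_zero_of_phiConv_eqOn (h := fun s => laplace P 1 (w s))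
    ⟨fun s _ => (hR.1 (w s)).1, hRw.prodMk (hAR ▸ hRw.sub hw)⟩
    (hAR ▸ hR.phiConv_apply_eqOn hP.one_sub_pos hw hdom hd)
  exact fun t ht => hR.injective _ (hzero ht)

theorem eqOn_of_isRegularizedStrongSolution (hP : IsSolutionKernel A α M P)
    (hu : IsRegularizedStrongSolution A α T 0 g u)
    (hv : IsRegularizedStrongSolution A α T 0 g v) : EqOn u v (Ico 0 T) := by
  intro t ht
  have hT := ht.1.trans_lt ht.2
  have huc := hu.regularity.continuousOn_Ico hT
  have hvc := hv.regularity.continuousOn_Ico hT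
  rcases ht.1.eq_or_lt with rfl | ht₀
  · rw [hu.regularity.initial, hv.regularity.initial]
  refine sub_eq_zero.1 (hP.eqOn_zero_of_hasDerivAt (w := fun s => u s - v s) (huc.sub hvc)
    (fun s hs => A.domain.sub_mem (hu.regularity.domain.1 s hs) (hv.regularity.domain.1 s hs))
    (fun s hs => ?_) ⟨ht₀, ht.2⟩)
  have hsub := (hu.hasDerivAt hs).sub (hv.hasDerivAt hs)
  rw [add_sub_add_right_eq_sub,
    ← opApply_sub (hu.regularity.domain.1 s hs) (hv.regularity.domain.1 s hs)] at hsub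
  refine hsub.congr_of_eventuallyEq ?_
  filter_upwards [isOpen_Ioo.mem_nhds hs] with r hr
  have hr' := Icc_subset_Ico_of_mem (Ioo_subset_Ico_self hr)
  exact phiConv_sub hP.one_sub_pos hr.1.le (huc.mono hr') (hvc.mono hr')

end IsSolutionKernel

end

end FracEvol

theorem theorem2p3_general {X : Type*} [NormedAddCommGroup X] [NormedSpace ℂ X] [CompleteSpace X]
    (A : X →ₗ.[ℂ] X) (θ₀ : ℝ) (hA : IsSectorial A θ₀)
    (α : ℝ) (hα₀ : 0 < α) (hα₁ : α < 1) (T : ℝ) (hT : 0 < T)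
    (g : ℝ → X) (hg : ContinuousOnDomain A g (Set.Ico 0 T)) (hg' : ContDiffOn ℝ 1 g (Set.Ico 0 T)) :
    (∃ γ : ℝ → ℂ, IsContour (angleOne α θ₀) γ) ∧
    ∀ γ : ℝ → ℂ, IsContour (angleOne α θ₀) γ →
      (∀ t : ℝ, 0 < t → MeasureTheory.Integrable (contourIntegrand A α γ t)) ∧
      (∀ z : ℂ, 0 < z.re →
        MeasureTheory.IntegrableOn (fun t : ℝ => Complex.exp (-z * (t : ℂ)) • opP A α γ t)
          (Set.Ioi 0) ∧
        ∫ t in Set.Ioi (0 : ℝ), Complex.exp (-z * (t : ℂ)) • opP A α γ t =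
          res A (z ^ (α : ℂ))) ∧
      (∀ t ∈ Set.Ico (0 : ℝ) T,
        IntervalIntegrable (fun s => opP A α γ (t - s) (g s)) MeasureTheory.volume 0 t) ∧
      IsStrongSolution A α T 0 g (convP A α γ g) ∧
      HasStrongRegularity A α (Set.Ico 0 T) 0 (convP A α γ g) ∧
      (∀ v : ℝ → X, IsStrongSolution A α T 0 g v →
        Set.EqOn v (convP A α γ g) (Set.Ico 0 T)) ∧
      (∀ v : ℝ → X, IsRegularizedStrongSolution A α T 0 g v →
        Set.EqOn v (convP A α γ g) (Set.Ico 0 T)) := by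
  refine ⟨⟨_, isContour_wedge (angleOne_pos hα₀ hα₁ hA.angle_pos) (angleOne_le α θ₀) one_pos⟩,
    fun γ hγ => ?_⟩
  obtain ⟨C, hL⟩ := hA.hasDecay hα₀ hα₁
  obtain ⟨M, hP⟩ := hA.isSolutionKernel hα₀ hα₁ hγ
  have hlaplace : HasLaplace (opP A α γ) fun z => res A (z ^ (α : ℂ)) := hL.hasLaplace_invLaplace hγ
  have hunique : ∀ v, IsRegularizedStrongSolution A α T 0 g v →
      Set.EqOn v (convP A α γ g) (Set.Ico 0 T) := fun v hv =>
    hP.eqOn_of_isRegularizedStrongSolution hv (hP.isRegularizedStrongSolution hg hT)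
  have hg₀ : ContinuousOn g (Set.Ioo 0 T) := hg.2.fst.mono Set.Ioo_subset_Ico_self
  exact ⟨fun t ht => hL.integrable hγ ht,
    fun z hz => ⟨hlaplace.integrableOn z hz, hlaplace.laplace_eq z hz⟩,
    fun t ht => hP.isKernel.intervalIntegrable_clm_apply_of_continuousOn ht.1
      (hg.2.fst.mono (Icc_subset_Ico_of_mem ht)),
    hP.isStrongSolution hg hg' hT, hP.hasStrongRegularity hg hT,
    fun v hv => hunique v (hv.isRegularizedStrongSolution hα₀.le hα₁ hg₀), hunique⟩

theorem theorem2p3 {X : Type*} [NormedAddCommGroup X] [NormedSpace ℂ X] [CompleteSpace X]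
    (A : X →ₗ.[ℂ] X) (hclosed : A.IsClosed) (hdense : Dense (A.domain : Set X))
    (θ₀ : ℝ) (hA : IsSectorial A θ₀)
    (α : ℝ) (hα₀ : 0 < α) (hα₁ : α < 1) (T : ℝ) (hT : 0 < T)
    (g : ℝ → X) (hg : C1OnDomain A g (Set.Ico 0 T)) :
    -- admissible contours exist
    (∃ γ : ℝ → ℂ, IsContour (angleOne α θ₀) γ) ∧
    ∀ γ : ℝ → ℂ, IsContour (angleOne α θ₀) γ →
      -- the contour integral converges
      (∀ t : ℝ, 0 < t → MeasureTheory.Integrable (contourIntegrand A α γ t)) ∧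
      -- the Laplace transform of `P_α` is the resolvent at `z ^ α`
      (∀ z : ℂ, 0 < z.re →
        MeasureTheory.IntegrableOn (fun t : ℝ => Complex.exp (-z * (t : ℂ)) • opP A α γ t)
          (Set.Ioi 0) ∧
        ∫ t in Set.Ioi (0 : ℝ), Complex.exp (-z * (t : ℂ)) • opP A α γ t =
          res A (z ^ (α : ℂ))) ∧
      -- the convolution integral converges
      (∀ t ∈ Set.Ico (0 : ℝ) T,
        IntervalIntegrable (fun s => opP A α γ (t - s) (g s)) MeasureTheory.volume 0 t) ∧
      -- `P_α * g` is a strong solution, with its regularity up to the initial time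
      IsStrongSolution A α T 0 g (convP A α γ g) ∧
      HasStrongRegularity A α (Set.Ico 0 T) 0 (convP A α γ g) ∧
      -- it is the only one, also with Caputo's derivative in its regularized form
      (∀ v : ℝ → X, IsStrongSolution A α T 0 g v →
        Set.EqOn v (convP A α γ g) (Set.Ico 0 T)) ∧
      (∀ v : ℝ → X, IsRegularizedStrongSolution A α T 0 g v →
        Set.EqOn v (convP A α γ g) (Set.Ico 0 T)) :=
  theorem2p3_general A θ₀ hA α hα₀ hα₁ T hT g ⟨hg.1, hg.2.continuousOn⟩ hg.2.fst
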